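/- **Conventions.** Let $A,B$ be finite-dimensional complex Hilbert spaces. A state on $A$ is a positive semidefinite operator of trace one; $\mathcal S(A)$ is the set of states. The support of an operator is the orthogonal complement of its kernel; $X\sim Y$ means equal supports and $X\ll Y$ means $\ker Y\subseteq\ker X$. Real powers of positive semidefinite operators are taken on the support. For $\alpha>1$ and positive semidefinite $\sigma$, the Petz divergence of a state $\rho$ is $D_\alpha(\rho\|\sigma)=\frac{1}{\alpha-1}\log\operatorname{tr}[\rho^\alpha\sigma^{1-\alpha}]$ if $\rho\ll\sigma$, and $D_\alpha(\rho\|\sigma)=\infty$ otherwise. For positive semidefinite $X,Y$ on the same space let $M(X/Y)=\inf\{\beta\in\mathbb R: X\le\beta Y\}$; Hilbert's projective metric is $d_H(X,Y)=\log\big(M(X/Y)M(Y/X)\big)$ if $X\sim Y$ and $Y\ne0$, $d_H(0,0)=0$, and $d_H(X,Y)=\infty$ otherwise. **Statement.** Let $\alpha\in(1,2]$, $\rho_{AB}\in\mathcal S(A\otimes B)$ with marginals $\rho_A=\operatorname{tr}_B[\rho_{AB}]$, $\rho_B=\operatorname{tr}_A[\rho_{AB}]$, and let $(\hat\sigma_A,\hat\tau_B)$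 be a minimizer of $D_\alpha(\rho_{AB}\|\sigma_A\otimes\tau_B)$ over $(\sigma_A,\tau_B)\in\mathcal S(A)\times\mathcal S(B)$. Let $\sigma_A^{(0)}\in\mathcal S(A)$ with $\sigma_A^{(0)}\sim\rho_A$, and for all $n\in\mathbb N=\{0,1,2,\dots\}$ let $$\tau_B^{(n)}=\frac{(\operatorname{tr}_A[\rho_{AB}^\alpha(\sigma_A^{(n)})^{1-\alpha}])^{1/\alpha}}{\operatorname{tr}[(\operatorname{tr}_A[\rho_{AB}^\alpha(\sigma_A^{(n)})^{1-\alpha}])^{1/\alpha}]},\qquad \sigma_A^{(n+1)}=\frac{(\operatorname{tr}_B[\rho_{AB}^\alpha(\tau_B^{(n)})^{1-\alpha}])^{1/\alpha}}{\operatorname{tr}[(\operatorname{tr}_B[\rho_{AB}^\alpha(\tau_B^{(n)})^{1-\alpha}])^{1/\alpha}]}.$$ Let $\gamma=|1-\frac1\alpha|$. (a) For all $n\in\mathbb N$, $$d_H(\sigma_A^{(n)},\hat\sigma_A)\le\gamma^{2n}d_H(\sigma_A^{(0)},\hat\sigma_A),\qquad d_H(\tau_B^{(n)},\hat\tau_B)\le\gamma^{2n+1}d_H(\sigma_A^{(0)},\hat\sigma_A).$$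 (b) If $\rho_{AB}$ is positive definite, let $\kappa=\tanh(\delta/4)$, where $$\delta=\log\max_{\phi,\psi}\ \big\|\langle\phi|\rho_{AB}^\alpha|\phi\rangle^{-\frac12}\langle\psi|\rho_{AB}^\alpha|\psi\rangle\langle\phi|\rho_{AB}^\alpha|\phi\rangle^{-\frac12}\big\|_\infty\cdot\big\|\langle\psi|\rho_{AB}^\alpha|\psi\rangle^{-\frac12}\langle\phi|\rho_{AB}^\alpha|\phi\rangle\langle\psi|\rho_{AB}^\alpha|\psi\rangle^{-\frac12}\big\|_\infty,$$ the maximum being over unit vectors $\phi,\psi\in A$ and $\|\cdot\|_\infty$ the operator norm on $B$. Then this maximum is attained, $\kappa\in[0,1)$, and for all $n\in\mathbb N$, $$d_H(\sigma_A^{(n)},\hat\sigma_A)\le(\gamma\kappa)^{2n}d_H(\sigma_A^{(0)},\hat\sigma_A),\qquad d_H(\tau_B^{(n)},\hat\tau_B)\le(\gamma\kappa)^{2n+1}d_H(\sigma_A^{(0)},\hat\sigma_A).$$ -/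

import Mathlib

open scoped ComplexOrder Kronecker

noncomputable section

namespace QState

/-! ### Hilbert's projective metric of a cone -/

section Cone

variable {V : Type*} [AddCommGroup V] [Module ℝ V]

/-- `y` dominates `x` with respect to the cone `C`:
`a • y ≤ x ≤ b • y` for some real numbers `a`, `b`, where `u ≤ v` means `v - u ∈ C`. -/
def Dominates (C : Set V) (y x : V) : Prop :=
  ∃ a b : ℝ, x - a • y ∈ C ∧ b • y - x ∈ C

/-- Equivalence of two elements of a cone: each dominates the other. -/
def ConeEquiv (C : Set V) (x y : V) : Prop :=
  Dominates C y x ∧ Dominates C x y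

/-- `M(x/y) = inf {β : x ≤ β • y}`. -/
def coneM (C : Set V) (x y : V) : ℝ :=
  sInf {β : ℝ | β • y - x ∈ C}

open Classical in
/-- Hilbert's projective metric of the cone `C`, for elements `x`, `y` of `C`, with values in
the extended reals. -/
def hilbertMetric (C : Set V) (x y : V) : EReal :=
  if ConeEquiv C x y ∧ y ≠ 0 then ((Real.log (coneM C x y * coneM C y x) : ℝ) : EReal)
  else if x = 0 ∧ y = 0 then 0
  else ⊤

end Cone

section Single

variable {n : Type*} [Fintype n] [DecidableEq n]

/-- The cone of positive semidefinite operators. -/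
def psdCone (n : Type*) [Fintype n] [DecidableEq n] : Set (Matrix n n ℂ) :=
  {X | X.PosSemidef}

/-- Hilbert's projective metric for the cone of positive semidefinite operators. -/
def dH (X Y : Matrix n n ℂ) : EReal :=
  hilbertMetric (psdCone n) X Y

/-- Quantum states: positive semidefinite operators of trace one. -/
def IsState (X : Matrix n n ℂ) : Prop :=
  X.PosSemidef ∧ X.trace = 1

/-- The kernel of an operator. -/
def ker (X : Matrix n n ℂ) : Submodule ℂ (EuclideanSpace ℂ n) :=
  LinearMap.ker (Matrix.toEuclideanLin X)

/-- The support of an operator: the orthogonal complement of its kernel. -/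
def supp (X : Matrix n n ℂ) : Submodule ℂ (EuclideanSpace ℂ n) :=
  (ker X)ᗮ

/-- `X ≪ Y`: the kernel of `Y` is contained in the kernel of `X`. -/
def AbsCont (X Y : Matrix n n ℂ) : Prop :=
  ker Y ≤ ker X

/-- `X ⊥ Y`: `X Y = Y X = 0`. -/
def Perp (X Y : Matrix n n ℂ) : Prop :=
  X * Y = 0 ∧ Y * X = 0

/-- `X ∼ Y`: equal supports. -/
def SameSupp (X Y : Matrix n n ℂ) : Prop :=
  supp X = supp Y

/-- The power `X ^ p` of a positive semidefinite operator, for real `p`, taken on the support of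
`X`: the eigenvalue `x > 0` becomes `x ^ p`, the eigenvalue `0` stays `0` (also for `p ≤ 0`). -/
def suppPow (X : Matrix n n ℂ) (p : ℝ) : Matrix n n ℂ :=
  cfc (fun x : ℝ => if x = 0 then 0 else x ^ p) X

/-- The operator norm with respect to the Euclidean norm (Schatten norm of order infinity). -/
def opNorm (X : Matrix n n ℂ) : ℝ :=
  ‖Matrix.toEuclideanCLM (𝕜 := ℂ) X‖

open Classical in
/-- The Petz divergence of order `α` (`0 ≤ α`, `α ≠ 1`). -/
def petzD (α : ℝ) (ρ σ : Matrix n n ℂ) : EReal :=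
  if (α < 1 ∧ ¬ Perp ρ σ) ∨ AbsCont ρ σ then
    ((1 / (α - 1) * Real.log ((suppPow ρ α * suppPow σ (1 - α)).trace.re) : ℝ) : EReal)
  else ⊤

end Single

/-! ### Bipartite systems: `A` has orthonormal basis `a`, `B` has orthonormal basis `b` -/

section Bipartite

variable {a b : Type*} [Fintype a] [DecidableEq a] [Fintype b] [DecidableEq b]

/-- Partial trace over `A`. -/
def trA (X : Matrix (a × b) (a × b) ℂ) : Matrix b b ℂ :=
  Matrix.of fun j j' => ∑ i, X (i, j) (i, j')

/-- Partial trace over `B`. -/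
def trB (X : Matrix (a × b) (a × b) ℂ) : Matrix a a ℂ :=
  Matrix.of fun i i' => ∑ j, X (i, j) (i', j)

/-- Division of an operator by its trace. -/
def normalize {n : Type*} [Fintype n] (X : Matrix n n ℂ) : Matrix n n ℂ :=
  X.trace⁻¹ • X

/-- The update map `σ_A ↦ (tr_A[ρ^α σ_A^(1-α)])^(1/α)`, normalized to trace one. -/
def NAB (α : ℝ) (ρ : Matrix (a × b) (a × b) ℂ) (σ : Matrix a a ℂ) : Matrix b b ℂ :=
  normalize (suppPow
    (trA (suppPow ρ α * (suppPow σ (1 - α) ⊗ₖ (1 : Matrix b b ℂ)))) (1 / α))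

/-- The update map `τ_B ↦ (tr_B[ρ^α τ_B^(1-α)])^(1/α)`, normalized to trace one. -/
def NBA (α : ℝ) (ρ : Matrix (a × b) (a × b) ℂ) (τ : Matrix b b ℂ) : Matrix a a ℂ :=
  normalize (suppPow
    (trB (suppPow ρ α * ((1 : Matrix a a ℂ) ⊗ₖ suppPow τ (1 - α)))) (1 / α))

/-- The iterates `σ_A^(n)` of alternating minimization started at `σ₀`. -/
def sigmaSeq (α : ℝ) (ρ : Matrix (a × b) (a × b) ℂ) (σ₀ : Matrix a a ℂ) : ℕ → Matrix a a ℂ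
  | 0 => σ₀
  | n + 1 => NBA α ρ (NAB α ρ (sigmaSeq α ρ σ₀ n))

/-- The iterates `τ_B^(n)` of alternating minimization started at `σ₀`. -/
def tauSeq (α : ℝ) (ρ : Matrix (a × b) (a × b) ℂ) (σ₀ : Matrix a a ℂ) (n : ℕ) : Matrix b b ℂ :=
  NAB α ρ (sigmaSeq α ρ σ₀ n)

/-- The global minimizers of `D_α(ρ_AB ‖ σ_A ⊗ τ_B)` over all pairs of states. -/
def minimizers (α : ℝ) (ρ : Matrix (a × b) (a × b) ℂ) :
    Set (Matrix a a ℂ × Matrix b b ℂ) :=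
  {p | (IsState p.1 ∧ IsState p.2) ∧
    ∀ (σ : Matrix a a ℂ) (τ : Matrix b b ℂ), IsState σ → IsState τ →
      petzD α ρ (p.1 ⊗ₖ p.2) ≤ petzD α ρ (σ ⊗ₖ τ)}

/-- The operator `⟨φ| Z |φ⟩` on `B`, for a vector `φ` of `A`. -/
def sandwich (Z : Matrix (a × b) (a × b) ℂ) (φ : EuclideanSpace ℂ a) : Matrix b b ℂ :=
  Matrix.of fun j j' => ∑ i, ∑ i', star (φ i) * Z (i, j) (i', j') * φ i'

/-- The norm `‖Y^(-1/2) X Y^(-1/2)‖` (operator norm). -/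
def relNorm {n : Type*} [Fintype n] [DecidableEq n] (X Y : Matrix n n ℂ) : ℝ :=
  opNorm (suppPow Y (-1 / 2) * X * suppPow Y (-1 / 2))

/-- The set of values over which the maximum in the definition of `δ` is taken; `φ` and `ψ` range
over the unit vectors of `A`. -/
def diamValues (α : ℝ) (ρ : Matrix (a × b) (a × b) ℂ) : Set ℝ :=
  {r | ∃ φ ψ : EuclideanSpace ℂ a, ‖φ‖ = 1 ∧ ‖ψ‖ = 1 ∧
    r = relNorm (sandwich (suppPow ρ α) ψ) (sandwich (suppPow ρ α) φ) *
        relNorm (sandwich (suppPow ρ α) φ) (sandwich (suppPow ρ α) ψ)}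

/-- The logarithm `δ` of the maximum of `diamValues`. -/
def delta (α : ℝ) (ρ : Matrix (a × b) (a × b) ℂ) : ℝ :=
  Real.log (sSup (diamValues α ρ))

/-- The contraction factor `κ = tanh (δ / 4)`. -/
def kappa (α : ℝ) (ρ : Matrix (a × b) (a × b) ℂ) : ℝ :=
  Real.tanh (delta α ρ / 4)

end Bipartite

end QState

end

/-! Each factor of a minimizing pair is a fixed point of the corresponding update map, and each
update map is a contraction for Hilbert's metric.

Fixed points: fix `σ` and put `W = tr_A[ρ^α σ^(1-α)]`. Testing minimality of `τ` against the
normalization `V` of `W^(1/α)` gives `tr[V^α τ^(1-α)] ≤ 1`, hence `V = τ` by strict positivity of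
the Petz divergence between states (`eq_of_trace_suppPow_le_one`, `eq_normalize_of_minimizer`). A
fixed point has the support of the marginal (`supp_normalize_contract`), so the initial distance is
finite.

Contraction: an update composes `X ↦ X^(1-α)`, the positive linear map `contract Z` with `Z = ρ^α`,
the power `1/α`, and a normalization, which Hilbert's metric does not see. By Löwner–Heinz and
antitonicity of the inverse, the powers scale the distance by at most `α - 1` (here `α ≤ 2` enters)
and `1/α`; together this is `γ`. A positive linear map does not increase the distance, which gives
(a).

For (b), the linear map contracts by `tanh (δ/4)`, a Birkhoff–Hopf theorem proved here through
cross-ratios of `⟨φ ⊗ v|Z|φ ⊗ v⟩` (`Comparable.contract`). The largest cross-ratio `K` exists by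
compactness and equals the maximum defining `δ` (`exists_isGreatest_diamValues`). Cross-ratios are
symmetric in the two factors, so one constant serves both updates.

The estimates are carried out with the real-valued relation `Comparable t X Y`, which stands for
`d_H(X, Y) ≤ log t`; extended reals enter only when converting to and from `dH`. -/

namespace QState

/-! ### Functional calculus, powers on the support, and support projections. -/

section FunctionalCalculus

open Matrix Polynomial
open scoped MatrixOrder

variable {n m : Type*} [Fintype n] [DecidableEq n] [Fintype m] [DecidableEq m]

lemma continuousOn_spectrum (A : Matrix n n ℂ) (f : ℝ → ℝ) : ContinuousOn f (spectrum ℝ A) :=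
  A.finite_real_spectrum.continuousOn f

/-- Real functions agree with a polynomial on a finite set. -/
lemma exists_polynomial_eqOn {S : Set ℝ} (hS : S.Finite) (f : ℝ → ℝ) :
    ∃ p : ℝ[X], ∀ x ∈ S, p.eval x = f x := by
  classical
  refine ⟨Lagrange.interpolate hS.toFinset id f, fun x hx => ?_⟩
  exact Lagrange.eval_interpolate_at_node (v := id) f (Function.injective_id.injOn)
    (hS.mem_toFinset.2 hx)

lemma cfc_eq_aeval {A : Matrix n n ℂ} (hA : A.IsHermitian) {f : ℝ → ℝ} {p : ℝ[X]}
    (h : ∀ x ∈ spectrum ℝ A, p.eval x = f x) : cfc f A = aeval A p := by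
  rw [← cfc_polynomial p A hA.isSelfAdjoint]
  exact cfc_congr fun x hx => (h x hx).symm

lemma aeval_mul_intertwine {A : Matrix n n ℂ} {B : Matrix m m ℂ} {M : Matrix n m ℂ}
    (h : A * M = M * B) (p : ℝ[X]) : aeval A p * M = M * aeval B p := by
  induction p using Polynomial.induction_on' with
  | add p q hp hq => simp only [map_add, Matrix.add_mul, Matrix.mul_add, hp, hq]
  | monomial k c =>
    have hk : A ^ k * M = M * B ^ k := by
      induction k with
      | zero => simp
      | succ k ih => rw [pow_succ', pow_succ', Matrix.mul_assoc, ih, ← Matrix.mul_assoc, h,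
          Matrix.mul_assoc]
    simp only [aeval_monomial, Algebra.algebraMap_eq_smul_one, smul_mul_assoc, one_mul]
    rw [Matrix.smul_mul, hk, Matrix.mul_smul]

/-- One polynomial interpolates `f` on both finite spectra, and polynomials respect intertwiners.
Allowing rectangular `M` covers single eigenvectors as well as changes of basis. -/
lemma cfc_mul_intertwine {A : Matrix n n ℂ} {B : Matrix m m ℂ} {M : Matrix n m ℂ}
    (hA : A.IsHermitian) (hB : B.IsHermitian) (h : A * M = M * B) (f : ℝ → ℝ) :
    cfc f A * M = M * cfc f B := by
  obtain ⟨p, hp⟩ := exists_polynomial_eqOn (A.finite_real_spectrum.union B.finite_real_spectrum) f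
  rw [cfc_eq_aeval hA (p := p) fun x hx => hp x (Or.inl hx),
    cfc_eq_aeval hB (p := p) fun x hx => hp x (Or.inr hx)]
  exact aeval_mul_intertwine h p

lemma cfc_mulVec_eigenvector {A : Matrix n n ℂ} (hA : A.IsHermitian) {v : n → ℂ} {c : ℝ}
    (h : A *ᵥ v = (c : ℂ) • v) (f : ℝ → ℝ) : cfc f A *ᵥ v = ((f c : ℝ) : ℂ) • v := by
  have hB : ((c : ℂ) • (1 : Matrix Unit Unit ℂ)).IsHermitian := by
    ext i j; simp [Matrix.smul_apply]
  have key := cfc_mul_intertwine (M := Matrix.replicateCol Unit v) hA hB (by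
    ext i j
    have := congrFun h i
    simpa [Matrix.mul_apply, Matrix.mulVec, dotProduct, mul_comm] using this) f
  have h1 : cfc f ((c : ℂ) • (1 : Matrix Unit Unit ℂ)) = ((f c : ℝ) : ℂ) • 1 := by
    have : ((c : ℂ) • (1 : Matrix Unit Unit ℂ)) = algebraMap ℝ _ c := by
      rw [Algebra.algebraMap_eq_smul_one]; ext i j; simp [Matrix.smul_apply]
    rw [this, cfc_algebraMap, Algebra.algebraMap_eq_smul_one]
    ext i j; simp [Matrix.smul_apply]
  rw [h1] at key
  funext i
  have := congrFun (congrFun key i) ()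
  simpa [Matrix.mul_apply, Matrix.mulVec, dotProduct, mul_comm] using this

/-- The function whose functional calculus is `suppPow · p`. -/
noncomputable def suppPowFun (p x : ℝ) : ℝ := if x = 0 then 0 else x ^ p

@[simp] lemma suppPowFun_zero (p : ℝ) : suppPowFun p 0 = 0 := by simp [suppPowFun]

lemma suppPowFun_nonneg (p : ℝ) {x : ℝ} (hx : 0 ≤ x) : 0 ≤ suppPowFun p x := by
  unfold suppPowFun; split_ifs <;> positivity

lemma suppPow_eq (X : Matrix n n ℂ) (p : ℝ) : suppPow X p = cfc (suppPowFun p) X := rfl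

lemma suppPowFun_mul {x y : ℝ} (hx : 0 ≤ x) (hy : 0 ≤ y) (p : ℝ) :
    suppPowFun p (x * y) = suppPowFun p x * suppPowFun p y := by
  unfold suppPowFun
  by_cases h : x = 0
  · simp [h]
  by_cases h' : y = 0
  · simp [h']
  simp [h, h', Real.mul_rpow hx hy]

lemma suppPowFun_add {x : ℝ} (hx : 0 ≤ x) (p q : ℝ) :
    suppPowFun (p + q) x = suppPowFun p x * suppPowFun q x := by
  unfold suppPowFun
  split_ifs with h
  · simp
  · exact Real.rpow_add (lt_of_le_of_ne hx (Ne.symm h)) p q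

lemma suppPowFun_suppPowFun {x : ℝ} (hx : 0 ≤ x) (p q : ℝ) :
    suppPowFun q (suppPowFun p x) = suppPowFun (p * q) x := by
  unfold suppPowFun
  split_ifs with h h' h'
  · rfl
  · exact absurd rfl h'
  · exact absurd h' (Real.rpow_pos_of_pos (lt_of_le_of_ne hx (Ne.symm h)) p).ne'
  · exact (Real.rpow_mul hx p q).symm

lemma spectrum_nonneg {X : Matrix n n ℂ} (hX : X.PosSemidef) {x : ℝ} (hx : x ∈ spectrum ℝ X) :
    0 ≤ x :=
  spectrum_nonneg_of_nonneg (Matrix.nonneg_iff_posSemidef.2 hX) hx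

lemma posSemidef_suppPow {X : Matrix n n ℂ} (hX : X.PosSemidef) (p : ℝ) :
    (suppPow X p).PosSemidef :=
  Matrix.nonneg_iff_posSemidef.1
    (cfc_nonneg fun _ hx => suppPowFun_nonneg p (spectrum_nonneg hX hx))

lemma suppPow_one {X : Matrix n n ℂ} (hX : X.PosSemidef) : suppPow X 1 = X := by
  rw [suppPow_eq]
  conv_rhs => rw [← cfc_id ℝ X hX.1.isSelfAdjoint]
  refine cfc_congr fun x _ => ?_
  simp only [suppPowFun, Real.rpow_one, id]
  split_ifs with h <;> simp [h]

lemma suppPow_mul_suppPow {X : Matrix n n ℂ} (hX : X.PosSemidef) (p q : ℝ) :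
    suppPow X p * suppPow X q = suppPow X (p + q) := by
  simp only [suppPow_eq]
  rw [← cfc_mul _ _ X (continuousOn_spectrum X _) (continuousOn_spectrum X _)]
  exact cfc_congr fun x hx => (suppPowFun_add (spectrum_nonneg hX hx) p q).symm

lemma suppPow_suppPow {X : Matrix n n ℂ} (hX : X.PosSemidef) (p q : ℝ) :
    suppPow (suppPow X p) q = suppPow X (p * q) := by
  simp only [suppPow_eq]
  rw [← cfc_comp' _ _ X ((X.finite_real_spectrum.image _).continuousOn _)
    (continuousOn_spectrum X _) hX.1.isSelfAdjoint]
  exact cfc_congr fun x hx => suppPowFun_suppPowFun (spectrum_nonneg hX hx) p q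

lemma suppPow_mul_self {X : Matrix n n ℂ} (hX : X.PosSemidef) (p : ℝ) :
    suppPow X p * X = suppPow X (p + 1) := by
  conv_lhs => rw [← suppPow_one hX, suppPow_suppPow hX, one_mul, suppPow_mul_suppPow hX]

lemma self_mul_suppPow {X : Matrix n n ℂ} (hX : X.PosSemidef) (p : ℝ) :
    X * suppPow X p = suppPow X (p + 1) := by
  conv_lhs => rw [← suppPow_one hX, suppPow_suppPow hX, one_mul, suppPow_mul_suppPow hX, add_comm]

lemma suppPow_smul {X : Matrix n n ℂ} (hX : X.PosSemidef) {c : ℝ} (hc : 0 < c) (p : ℝ) :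
    suppPow (c • X) p = (c ^ p) • suppPow X p := by
  rw [suppPow_eq, suppPow_eq, ← cfc_comp_smul c _ X
    ((X.finite_real_spectrum.image _).continuousOn _) hX.1.isSelfAdjoint,
    ← cfc_smul (c ^ p) _ X (continuousOn_spectrum X _)]
  refine cfc_congr fun x hx => ?_
  have := suppPowFun_mul hc.le (spectrum_nonneg hX hx) p
  simp only [smul_eq_mul, this]
  congr 1
  simp [suppPowFun, hc.ne']

/-- Functional calculus in an eigenbasis. -/
lemma cfc_spectral {A : Matrix n n ℂ} (hA : A.IsHermitian) (f : ℝ → ℝ) :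
    cfc f A * (hA.eigenvectorUnitary : Matrix n n ℂ) =
      hA.eigenvectorUnitary * diagonal (fun i => ((f (hA.eigenvalues i) : ℝ) : ℂ)) := by
  rw [hA.cfc_eq, Matrix.IsHermitian.cfc, Unitary.conjStarAlgAut_apply, Matrix.mul_assoc,
    Unitary.coe_star_mul_self, Matrix.mul_one]
  rfl

/-- The tensor product of the two eigenbases diagonalizes `X ⊗ₖ Y` with products of eigenvalues, and
`suppPowFun p` is multiplicative on nonnegative reals, zero included. -/
lemma suppPow_kronecker {X : Matrix n n ℂ} {Y : Matrix m m ℂ} (hX : X.PosSemidef)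
    (hY : Y.PosSemidef) (p : ℝ) : suppPow (X ⊗ₖ Y) p = suppPow X p ⊗ₖ suppPow Y p := by
  have hXY := hX.kronecker hY
  set U : Matrix n n ℂ := ↑hX.1.eigenvectorUnitary
  set T : Matrix m m ℂ := ↑hY.1.eigenvectorUnitary
  have hUU : U * star U = 1 := Unitary.coe_mul_star_self _
  have hTT : T * star T = 1 := Unitary.coe_mul_star_self _
  have hW : (U ⊗ₖ T) * (star U ⊗ₖ star T) = 1 := by
    rw [← Matrix.mul_kronecker_mul, hUU, hTT, Matrix.one_kronecker_one]
  have hidX : X * U = U * diagonal (fun i => ((hX.1.eigenvalues i : ℝ) : ℂ)) := by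
    have := cfc_spectral hX.1 id
    rwa [cfc_id ℝ X hX.1.isSelfAdjoint] at this
  have hidY : Y * T = T * diagonal (fun i => ((hY.1.eigenvalues i : ℝ) : ℂ)) := by
    have := cfc_spectral hY.1 id
    rwa [cfc_id ℝ Y hY.1.isSelfAdjoint] at this
  have hB := cfc_mul_intertwine hXY.1 (M := U ⊗ₖ T)
    (B := diagonal fun ij : n × m => ((hX.1.eigenvalues ij.1 * hY.1.eigenvalues ij.2 : ℝ) : ℂ))
    (by ext i j; by_cases h : i = j
        · subst h; simp
        · simp [Matrix.diagonal_apply_ne _ h, Matrix.diagonal_apply_ne _ (Ne.symm h)])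
    (by
      rw [← Matrix.mul_kronecker_mul, hidX, hidY, Matrix.mul_kronecker_mul,
        Matrix.diagonal_kronecker_diagonal]
      simp) (suppPowFun p)
  have hD : cfc (suppPowFun p) (diagonal fun ij : n × m =>
      ((hX.1.eigenvalues ij.1 * hY.1.eigenvalues ij.2 : ℝ) : ℂ)) =
      diagonal (fun i => ((suppPowFun p (hX.1.eigenvalues i) : ℝ) : ℂ)) ⊗ₖ
      diagonal (fun i => ((suppPowFun p (hY.1.eigenvalues i) : ℝ) : ℂ)) := by
    rw [Matrix.diagonal_kronecker_diagonal]
    refine Matrix.ext_of_mulVec_single fun ij => ?_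
    rw [cfc_mulVec_eigenvector (c := hX.1.eigenvalues ij.1 * hY.1.eigenvalues ij.2)]
    · funext kl
      by_cases h : kl = ij
      · subst h
        simp [suppPowFun_mul (hX.eigenvalues_nonneg _) (hY.eigenvalues_nonneg _)]
      · simp [h]
    · ext i j; by_cases h : i = j
      · subst h; simp
      · simp [Matrix.diagonal_apply_ne _ h, Matrix.diagonal_apply_ne _ (Ne.symm h)]
    · funext kl
      by_cases h : kl = ij
      · subst h; simp
      · simp [h]
  rw [hD] at hB
  have hR : (suppPow X p ⊗ₖ suppPow Y p) * (U ⊗ₖ T) = (U ⊗ₖ T) *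
      (diagonal (fun i => ((suppPowFun p (hX.1.eigenvalues i) : ℝ) : ℂ)) ⊗ₖ
      diagonal (fun i => ((suppPowFun p (hY.1.eigenvalues i) : ℝ) : ℂ))) := by
    rw [← Matrix.mul_kronecker_mul, ← Matrix.mul_kronecker_mul, suppPow_eq, suppPow_eq,
      cfc_spectral hX.1, cfc_spectral hY.1]
  calc suppPow (X ⊗ₖ Y) p = suppPow (X ⊗ₖ Y) p * ((U ⊗ₖ T) * (star U ⊗ₖ star T)) := by
        rw [hW, Matrix.mul_one]
    _ = (suppPow X p ⊗ₖ suppPow Y p) * ((U ⊗ₖ T) * (star U ⊗ₖ star T)) := by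
        rw [← Matrix.mul_assoc, suppPow_eq, hB, ← hR, Matrix.mul_assoc]
    _ = _ := by rw [hW, Matrix.mul_one]

lemma mul_one_sub_supp {X : Matrix n n ℂ} (hX : X.PosSemidef) : X * (1 - suppPow X 0) = 0 := by
  rw [Matrix.mul_sub, Matrix.mul_one, self_mul_suppPow hX, zero_add, suppPow_one hX, sub_self]

lemma mem_ker {X : Matrix n n ℂ} {v : EuclideanSpace ℂ n} : v ∈ ker X ↔ X *ᵥ v.ofLp = 0 := by
  rw [ker, LinearMap.mem_ker, Matrix.toLpLin_apply]
  exact ⟨fun h => by simpa using congrArg WithLp.ofLp h, fun h => by simp [h]⟩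

/-- `suppPow Y 0` is the projection onto the support of `Y`; absolute continuity thus becomes an
algebraic absorption identity, the form in which supports are handled below. -/
lemma absCont_iff {X Y : Matrix n n ℂ} (hY : Y.PosSemidef) :
    AbsCont X Y ↔ X * suppPow Y 0 = X := by
  constructor
  · intro h
    have h0 : X * (1 - suppPow Y 0) = 0 := by
      refine Matrix.ext_of_mulVec_single fun i => ?_
      rw [← Matrix.mulVec_mulVec, Matrix.zero_mulVec]
      refine (mem_ker (v := WithLp.toLp 2 _)).1 (h (mem_ker.2 ?_))
      change Y *ᵥ ((1 - suppPow Y 0) *ᵥ _) = 0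
      rw [Matrix.mulVec_mulVec, mul_one_sub_supp hY, Matrix.zero_mulVec]
    rw [Matrix.mul_sub, Matrix.mul_one, sub_eq_zero] at h0
    exact h0.symm
  · intro h v hv
    rw [mem_ker] at hv ⊢
    have : suppPow Y 0 *ᵥ v.ofLp = 0 := by
      rw [← neg_add_cancel (1 : ℝ), ← suppPow_mul_self hY, ← Matrix.mulVec_mulVec, hv,
        Matrix.mulVec_zero]
    rw [← h, ← Matrix.mulVec_mulVec, this, Matrix.mulVec_zero]

lemma isHermitian_suppPow (X : Matrix n n ℂ) (p : ℝ) : (suppPow X p).IsHermitian :=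
  cfc_predicate (p := IsSelfAdjoint) _ X

lemma supp_eq_of_mul_supp_eq {X Y : Matrix n n ℂ} (hX : X.PosSemidef) (hY : Y.PosSemidef)
    (h : X * suppPow Y 0 = X) (h' : Y * suppPow X 0 = Y) : suppPow X 0 = suppPow Y 0 := by
  have h1 : suppPow X 0 * suppPow Y 0 = suppPow X 0 := by
    rw [← neg_add_cancel (1 : ℝ), ← suppPow_mul_self hX, neg_add_cancel, Matrix.mul_assoc, h]
  have h2 : suppPow Y 0 * suppPow X 0 = suppPow Y 0 := by
    rw [← neg_add_cancel (1 : ℝ), ← suppPow_mul_self hY, neg_add_cancel, Matrix.mul_assoc, h']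
  have := congrArg Matrix.conjTranspose h1
  rw [Matrix.conjTranspose_mul, (isHermitian_suppPow X 0).eq, (isHermitian_suppPow Y 0).eq] at this
  rw [← this, h2]

lemma sameSupp_iff {X Y : Matrix n n ℂ} (hX : X.PosSemidef) (hY : Y.PosSemidef) :
    SameSupp X Y ↔ suppPow X 0 = suppPow Y 0 := by
  have hk : SameSupp X Y ↔ ker X = ker Y :=
    ⟨fun h => by simpa [supp] using congrArg Submodule.orthogonal h,
      fun h => congrArg Submodule.orthogonal h⟩
  rw [hk]
  constructor
  · intro h
    exact supp_eq_of_mul_supp_eq hX hY ((absCont_iff hY).1 h.ge) ((absCont_iff hX).1 h.le)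
  · intro h
    refine le_antisymm ((absCont_iff hX).2 ?_) ((absCont_iff hY).2 ?_)
    · rw [h, self_mul_suppPow hY, zero_add, suppPow_one hY]
    · rw [← h, self_mul_suppPow hX, zero_add, suppPow_one hX]

end FunctionalCalculus

/-! ### Two-sided order bounds, their behaviour under powers, and Hilbert's metric. -/

section Comparable

open Matrix

set_option linter.unusedSectionVars false

variable {n m : Type*} [Fintype n] [DecidableEq n] [Fintype m] [DecidableEq m]

/-- The quadratic form of an operator. -/
def quadForm (X : Matrix n n ℂ) (v : n → ℂ) : ℝ := (star v ⬝ᵥ X *ᵥ v).re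

lemma quadForm_add (X Y : Matrix n n ℂ) (v : n → ℂ) :
    quadForm (X + Y) v = quadForm X v + quadForm Y v := by
  simp [quadForm, Matrix.add_mulVec, dotProduct_add]

lemma quadForm_sub (X Y : Matrix n n ℂ) (v : n → ℂ) :
    quadForm (X - Y) v = quadForm X v - quadForm Y v := by
  simp [quadForm, Matrix.sub_mulVec, dotProduct_sub]

lemma quadForm_smul (c : ℝ) (X : Matrix n n ℂ) (v : n → ℂ) :
    quadForm (c • X) v = c * quadForm X v := by
  simp [quadForm, Matrix.smul_mulVec, dotProduct_smul]

lemma isHermitian_real_smul {X : Matrix n n ℂ} (hX : X.IsHermitian) (c : ℝ) :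
    (c • X).IsHermitian := by
  rw [Matrix.IsHermitian, Matrix.conjTranspose_smul, hX.eq, star_trivial]

lemma posSemidef_iff_quadForm {X : Matrix n n ℂ} (hX : X.IsHermitian) :
    X.PosSemidef ↔ ∀ v, 0 ≤ quadForm X v := by
  rw [posSemidef_iff_dotProduct_mulVec]
  refine ⟨fun h v => (Complex.le_def.1 (h.2 v)).1, fun h => ⟨hX, fun v => ?_⟩⟩
  refine Complex.le_def.2 ⟨h v, ?_⟩
  exact (hX.im_star_dotProduct_mulVec_self v).symm

lemma posSemidef_smul_sub_iff {X Y : Matrix n n ℂ} (hX : X.IsHermitian) (hY : Y.IsHermitian)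
    (β : ℝ) : (β • Y - X).PosSemidef ↔ ∀ v, quadForm X v ≤ β * quadForm Y v := by
  rw [posSemidef_iff_quadForm ((isHermitian_real_smul hY β).sub hX)]
  simp only [quadForm_sub, quadForm_smul, sub_nonneg]

lemma quadForm_nonneg {X : Matrix n n ℂ} (hX : X.PosSemidef) (v : n → ℂ) : 0 ≤ quadForm X v :=
  (posSemidef_iff_quadForm hX.1).1 hX v

lemma quadForm_pos {X : Matrix n n ℂ} (hX : X.PosDef) {v : n → ℂ} (hv : v ≠ 0) :
    0 < quadForm X v :=
  (Complex.lt_def.1 (hX.dotProduct_mulVec_pos hv)).1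

lemma exists_quadForm_pos {X : Matrix n n ℂ} (hX : X.PosSemidef) (h0 : X ≠ 0) :
    ∃ v, 0 < quadForm X v := by
  by_contra! h
  refine h0 (Matrix.ext_of_mulVec_single fun i => ?_)
  rw [Matrix.zero_mulVec, ← hX.dotProduct_mulVec_zero_iff]
  refine Complex.ext (le_antisymm (h _) (quadForm_nonneg hX _)) ?_
  exact hX.1.im_star_dotProduct_mulVec_self _

lemma exists_eq_conjTranspose_mul_self {A : Matrix n n ℂ} (hA : A.PosSemidef) :
    ∃ D : Matrix n n ℂ, A = Dᴴ * D := by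
  refine ⟨suppPow A (1 / 2), ?_⟩
  rw [(isHermitian_suppPow A _).eq, suppPow_mul_suppPow hA]
  norm_num [suppPow_one hA]

lemma mul_eq_zero_of_conj {A : Matrix n n ℂ} (hA : A.PosSemidef) {M : Matrix n m ℂ}
    (h : Mᴴ * A * M = 0) : A * M = 0 := by
  obtain ⟨D, rfl⟩ := exists_eq_conjTranspose_mul_self hA
  have : D * M = 0 := by
    rw [← Matrix.conjTranspose_mul_self_eq_zero, Matrix.conjTranspose_mul, ← h]
    simp only [Matrix.mul_assoc]
  rw [Matrix.mul_assoc, this, Matrix.mul_zero]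

lemma mul_eq_zero_of_trace_mul {A B : Matrix n n ℂ} (hA : A.PosSemidef) (hB : B.PosSemidef)
    (h : (A * B).trace = 0) : A * B = 0 := by
  obtain ⟨C, rfl⟩ := exists_eq_conjTranspose_mul_self hB
  have h1 : (C * A * Cᴴ).PosSemidef := hA.mul_mul_conjTranspose_same C
  have h2 : (Cᴴ)ᴴ * A * Cᴴ = 0 := by
    rw [Matrix.conjTranspose_conjTranspose, ← h1.trace_eq_zero_iff, Matrix.trace_mul_cycle,
      Matrix.trace_mul_comm, h]
  rw [← Matrix.mul_assoc, mul_eq_zero_of_conj hA h2, Matrix.zero_mul]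

lemma trace_mul_nonneg {A B : Matrix n n ℂ} (hA : A.PosSemidef) (hB : B.PosSemidef) :
    0 ≤ (A * B).trace := by
  obtain ⟨C, rfl⟩ := exists_eq_conjTranspose_mul_self hB
  have h1 : (C * A * Cᴴ).PosSemidef := hA.mul_mul_conjTranspose_same C
  have h2 := h1.trace_nonneg
  rwa [Matrix.trace_mul_cycle, Matrix.trace_mul_comm] at h2

/-- `X` and `Y` bound each other up to factors whose product is at most `t`. -/
def Comparable (t : ℝ) (X Y : Matrix n n ℂ) : Prop :=
  ∃ β β' : ℝ, 0 < β ∧ 0 < β' ∧ β * β' ≤ t ∧ (β • Y - X).PosSemidef ∧ (β' • X - Y).PosSemidef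

/-- Compression by the projection `Q` onto the kernel of `Y` turns the hypothesis into `-(Q X Q) ≥
0`, while `Q X Q ≥ 0`; hence `Q X Q = 0` and `X Q = 0`. -/
lemma mul_supp_eq_of_le {X Y : Matrix n n ℂ} (hX : X.PosSemidef) (hY : Y.PosSemidef) {β : ℝ}
    (h : (β • Y - X).PosSemidef) : X * suppPow Y 0 = X := by
  set Q := 1 - suppPow Y 0 with hQ
  have hYQ : Y * Q = 0 := mul_one_sub_supp hY
  have h1 := h.conjTranspose_mul_mul_same Q
  have h2 := hX.conjTranspose_mul_mul_same Q
  have h3 : Qᴴ * (β • Y - X) * Q = -(Qᴴ * X * Q) := by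
    rw [Matrix.mul_assoc, Matrix.sub_mul, Matrix.smul_mul, hYQ, smul_zero, zero_sub,
      Matrix.mul_neg, Matrix.mul_assoc]
  rw [h3] at h1
  have h4 : Qᴴ * X * Q = 0 := by
    rw [← h2.trace_eq_zero_iff]
    have := h1.trace_nonneg
    rw [Matrix.trace_neg, neg_nonneg] at this
    exact le_antisymm this h2.trace_nonneg
  have h5 := mul_eq_zero_of_conj hX h4
  rw [hQ, Matrix.mul_sub, Matrix.mul_one, sub_eq_zero] at h5
  exact h5.symm

lemma Comparable.supp_eq {t : ℝ} {X Y : Matrix n n ℂ} (hX : X.PosSemidef) (hY : Y.PosSemidef)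
    (h : Comparable t X Y) : suppPow X 0 = suppPow Y 0 := by
  obtain ⟨β, β', -, -, -, h1, h2⟩ := h
  exact supp_eq_of_mul_supp_eq hX hY (mul_supp_eq_of_le hX hY h1) (mul_supp_eq_of_le hY hX h2)

lemma Comparable.smul {t : ℝ} {X Y : Matrix n n ℂ} (h : Comparable t X Y) {c d : ℝ} (hc : 0 < c)
    (hd : 0 < d) : Comparable t (c • X) (d • Y) := by
  obtain ⟨β, β', h1, h2, h3, h4, h5⟩ := h
  refine ⟨β * c / d, β' * d / c, by positivity, by positivity, ?_, ?_, ?_⟩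
  · have : β * c / d * (β' * d / c) = β * β' := by field_simp
    rwa [this]
  · have := h4.smul hc.le
    rwa [smul_sub, smul_smul, mul_comm c, ← div_mul_cancel₀ (β * c) hd.ne', ← smul_smul] at this
  · have := h5.smul hd.le
    rwa [smul_sub, smul_smul, mul_comm d, ← div_mul_cancel₀ (β' * d) hc.ne', ← smul_smul] at this

lemma Comparable.map {t : ℝ} {X Y : Matrix n n ℂ} (h : Comparable t X Y)
    (L : Matrix n n ℂ →ₗ[ℝ] Matrix m m ℂ) (hL : ∀ X, X.PosSemidef → (L X).PosSemidef) :
    Comparable t (L X) (L Y) := by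
  obtain ⟨β, β', h1, h2, h3, h4, h5⟩ := h
  refine ⟨β, β', h1, h2, h3, ?_, ?_⟩
  · simpa using hL _ h4
  · simpa using hL _ h5

section Loewner

open scoped MatrixOrder Matrix.Norms.L2Operator

lemma suppPow_eq_rpow {X : Matrix n n ℂ} (hX : X.PosSemidef) {p : ℝ} (hp : 0 < p) :
    suppPow X p = X ^ p := by
  rw [CFC.rpow_eq_cfc_real (Matrix.nonneg_iff_posSemidef.2 hX), suppPow_eq]
  refine cfc_congr fun x _ => ?_
  unfold suppPowFun
  split_ifs with h
  · simp [h, Real.zero_rpow hp.ne']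
  · rfl

/-- The Löwner–Heinz inequality. -/
lemma suppPow_monotone {X Y : Matrix n n ℂ} (hX : X.PosSemidef) (hY : Y.PosSemidef)
    (h : (Y - X).PosSemidef) {p : ℝ} (hp : 0 < p) (hp1 : p ≤ 1) :
    (suppPow Y p - suppPow X p).PosSemidef := by
  rw [suppPow_eq_rpow hX hp, suppPow_eq_rpow hY hp]
  exact CFC.rpow_le_rpow ⟨hp.le, hp1⟩ (Matrix.le_iff.2 h)

lemma exists_smul_one_sub_posSemidef {X : Matrix n n ℂ} (hX : X.PosSemidef) :
    ∃ c : ℝ, 0 < c ∧ (c • (1 : Matrix n n ℂ) - X).PosSemidef := by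
  refine ⟨‖X‖ + 1, by positivity, ?_⟩
  have h : X ≤ algebraMap ℝ (Matrix n n ℂ) ‖X‖ := hX.1.isSelfAdjoint.le_algebraMap_norm_self
  rw [Algebra.algebraMap_eq_smul_one, Matrix.le_iff] at h
  have := h.add Matrix.PosSemidef.one
  convert! this using 1
  rw [add_smul, one_smul]; abel

end Loewner

/-- With `A`, `B` the inverses of `X`, `Y` on the common support, `A - B = (A - B) X (A - B) + B (Y
- X) B`, a sum of two positive terms. Equality of the supports is what makes `A X B = B`. -/
lemma suppPow_neg_one_antitone {X Y : Matrix n n ℂ} (hX : X.PosSemidef) (hY : Y.PosSemidef)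
    (h : (Y - X).PosSemidef) (hs : suppPow X 0 = suppPow Y 0) :
    (suppPow X (-1) - suppPow Y (-1)).PosSemidef := by
  set A := suppPow X (-1) with hA
  set B := suppPow Y (-1) with hB
  have hAX : A * X = suppPow X 0 := by rw [hA, suppPow_mul_self hX]; norm_num
  have hXA : X * A = suppPow X 0 := by rw [hA, self_mul_suppPow hX]; norm_num
  have hBY : B * Y = suppPow Y 0 := by rw [hB, suppPow_mul_self hY]; norm_num
  have hPA : suppPow X 0 * A = A := by rw [hA, suppPow_mul_suppPow hX]; norm_num
  have hPB : suppPow Y 0 * B = B := by rw [hB, suppPow_mul_suppPow hY]; norm_num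
  have hBP : B * suppPow Y 0 = B := by rw [hB, suppPow_mul_suppPow hY]; norm_num
  have hAh : Aᴴ = A := (isHermitian_suppPow X _).eq
  have hBh : Bᴴ = B := (isHermitian_suppPow Y _).eq
  have h1 := (hX.conjTranspose_mul_mul_same (A - B)).add (h.conjTranspose_mul_mul_same B)
  convert! h1 using 1
  rw [Matrix.conjTranspose_sub, hAh, hBh]
  have e1 : A * X * A = A := by rw [hAX, hPA]
  have e2 : A * X * B = B := by rw [hAX, hs, hPB]
  have e3 : B * X * A = B := by rw [Matrix.mul_assoc, hXA, hs, hBP]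
  have e4 : B * Y * B = B := by rw [hBY, hPB]
  simp only [Matrix.sub_mul, Matrix.mul_sub, e1, e2, e3, e4]
  abel

lemma Comparable.suppPow {t : ℝ} {X Y : Matrix n n ℂ} (h : Comparable t X Y) (hX : X.PosSemidef)
    (hY : Y.PosSemidef) {p : ℝ} (hp : 0 < p) (hp1 : p ≤ 1) :
    Comparable (t ^ p) (suppPow X p) (suppPow Y p) := by
  obtain ⟨β, β', h1, h2, h3, h4, h5⟩ := h
  refine ⟨β ^ p, β' ^ p, by positivity, by positivity, ?_, ?_, ?_⟩
  · rw [← Real.mul_rpow h1.le h2.le]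
    exact Real.rpow_le_rpow (by positivity) h3 hp.le
  · rw [← suppPow_smul hY h1]
    exact suppPow_monotone hX (hY.smul h1.le) h4 hp hp1
  · rw [← suppPow_smul hX h2]
    exact suppPow_monotone hY (hX.smul h2.le) h5 hp hp1

lemma suppPow_zero_smul {X : Matrix n n ℂ} (hX : X.PosSemidef) {c : ℝ} (hc : 0 < c) :
    QState.suppPow (c • X) 0 = QState.suppPow X 0 := by
  rw [suppPow_smul hX hc, Real.rpow_zero, one_smul]

lemma Comparable.suppPow_neg_one {t : ℝ} {X Y : Matrix n n ℂ} (h : Comparable t X Y)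
    (hX : X.PosSemidef) (hY : Y.PosSemidef) :
    Comparable t (QState.suppPow X (-1)) (QState.suppPow Y (-1)) := by
  have hs := h.supp_eq hX hY
  obtain ⟨β, β', h1, h2, h3, h4, h5⟩ := h
  have key : ∀ {A B : Matrix n n ℂ} {β : ℝ}, A.PosSemidef → B.PosSemidef → 0 < β →
      (β • B - A).PosSemidef → QState.suppPow A 0 = QState.suppPow B 0 →
      (β • QState.suppPow A (-1) - QState.suppPow B (-1)).PosSemidef := by
    intro A B β hA hB hβ h hs
    have := (suppPow_neg_one_antitone hA (hB.smul hβ.le) h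
      (by rw [hs, suppPow_zero_smul hB hβ])).smul hβ.le
    rwa [suppPow_smul hB hβ, smul_sub, smul_smul, Real.rpow_neg_one, mul_inv_cancel₀ hβ.ne',
      one_smul] at this
  exact ⟨β', β, h2, h1, by rwa [mul_comm], key hY hX h2 h5 hs.symm, key hX hY h1 h4 hs⟩

/-- A negative power is the inverse of a positive one: Löwner–Heinz shrinks `log t` by the factor
`p`, and inversion merely swaps the two bounds. -/
lemma Comparable.suppPow_neg {t : ℝ} {X Y : Matrix n n ℂ} (h : Comparable t X Y)
    (hX : X.PosSemidef) (hY : Y.PosSemidef) {p : ℝ} (hp : 0 < p) (hp1 : p ≤ 1) :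
    Comparable (t ^ p) (QState.suppPow X (-p)) (QState.suppPow Y (-p)) := by
  have := (h.suppPow hX hY hp hp1).suppPow_neg_one (posSemidef_suppPow hX p)
    (posSemidef_suppPow hY p)
  rwa [suppPow_suppPow hX, suppPow_suppPow hY, mul_neg_one] at this

/-- With `P` the common support projection, `X = P X P ≤ c P`, and `P = Y^(1/2) Y^(-1) Y^(1/2) ≤ d
Y`. -/
lemma exists_smul_sub_posSemidef {X Y : Matrix n n ℂ} (hX : X.PosSemidef) (hY : Y.PosSemidef)
    (hs : suppPow X 0 = suppPow Y 0) : ∃ β : ℝ, 0 < β ∧ (β • Y - X).PosSemidef := by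
  obtain ⟨c, hc, h1⟩ := exists_smul_one_sub_posSemidef hX
  obtain ⟨d, hd, h2⟩ := exists_smul_one_sub_posSemidef (posSemidef_suppPow hY (-1))
  refine ⟨c * d, by positivity, ?_⟩
  have h3 := h1.conjTranspose_mul_mul_same (suppPow X 0)
  have h4 := (h2.conjTranspose_mul_mul_same (suppPow Y (1 / 2))).smul hc.le
  convert! h3.add h4 using 1
  have e1 : suppPow X 0 * X * suppPow X 0 = X := by
    rw [suppPow_mul_self hX, suppPow_mul_suppPow hX]; norm_num [suppPow_one hX]
  have e2 : suppPow Y (1 / 2) * suppPow Y (-1) * suppPow Y (1 / 2) = suppPow Y 0 := by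
    rw [suppPow_mul_suppPow hY, suppPow_mul_suppPow hY]; norm_num
  have e3 : suppPow Y (1 / 2) * suppPow Y (1 / 2) = Y := by
    rw [suppPow_mul_suppPow hY]; norm_num [suppPow_one hY]
  have e4 : suppPow X 0 * suppPow X 0 = suppPow X 0 := by
    rw [suppPow_mul_suppPow hX]; norm_num
  rw [(isHermitian_suppPow X _).eq, (isHermitian_suppPow Y _).eq]
  rw [hs] at e1 e4
  simp only [Matrix.mul_sub, Matrix.sub_mul, Matrix.mul_smul, Matrix.smul_mul, Matrix.mul_one,
    e1, e2, e3, e4, hs, smul_sub, smul_smul]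
  abel

lemma exists_comparable {X Y : Matrix n n ℂ} (hX : X.PosSemidef) (hY : Y.PosSemidef)
    (hs : suppPow X 0 = suppPow Y 0) : ∃ t, Comparable t X Y := by
  obtain ⟨β, h1, h2⟩ := exists_smul_sub_posSemidef hX hY hs
  obtain ⟨β', h3, h4⟩ := exists_smul_sub_posSemidef hY hX hs.symm
  exact ⟨β * β', β, β', h1, h3, le_rfl, h2, h4⟩

lemma pos_of_smul_sub {X Y : Matrix n n ℂ} (hX : X.PosSemidef) (hY : Y.PosSemidef) (h0 : X ≠ 0)
    {β : ℝ} (h : (β • Y - X).PosSemidef) : 0 < β := by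
  obtain ⟨v, hv⟩ := exists_quadForm_pos hX h0
  have := (posSemidef_smul_sub_iff hX.1 hY.1 β).1 h v
  have h2 := quadForm_nonneg hY v
  by_contra! h3
  nlinarith [mul_nonpos_of_nonpos_of_nonneg h3 h2]

lemma ne_zero_of_smul_sub {X Y : Matrix n n ℂ} (hY : Y.PosSemidef) (h0 : Y ≠ 0)
    {β : ℝ} (h : (β • X - Y).PosSemidef) : X ≠ 0 := by
  rintro rfl
  rw [smul_zero, zero_sub] at h
  refine h0 (hY.trace_eq_zero_iff.1 (le_antisymm ?_ hY.trace_nonneg))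
  simpa using h.trace_nonneg

lemma Comparable.ne_zero {t : ℝ} {X Y : Matrix n n ℂ} (h : Comparable t X Y) (hY : Y.PosSemidef)
    (h0 : Y ≠ 0) : X ≠ 0 := by
  obtain ⟨β, β', -, -, -, -, h5⟩ := h
  exact ne_zero_of_smul_sub hY h0 h5

lemma one_le_of_smul_sub {X Y : Matrix n n ℂ} (hX : X.PosSemidef) (hY : Y.PosSemidef)
    (h0 : X ≠ 0) {β β' : ℝ} (hβ : 0 ≤ β) (h : (β • Y - X).PosSemidef)
    (h' : (β' • X - Y).PosSemidef) : 1 ≤ β * β' := by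
  obtain ⟨v, hv⟩ := exists_quadForm_pos hX h0
  have h1 := (posSemidef_smul_sub_iff hX.1 hY.1 β).1 h v
  have h2 := (posSemidef_smul_sub_iff hY.1 hX.1 β').1 h' v
  by_contra! h3
  nlinarith [mul_le_mul_of_nonneg_left h2 hβ]

lemma coneM_le {X Y : Matrix n n ℂ} (hX : X.PosSemidef) (hY : Y.PosSemidef) (h0 : X ≠ 0)
    {β : ℝ} (h : (β • Y - X).PosSemidef) : coneM (psdCone n) X Y ≤ β :=
  csInf_le ⟨0, fun _ hb => (pos_of_smul_sub hX hY h0 hb).le⟩ h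

/-- The infimum is attained: for each vector the condition on `β` is vacuous or reads `quotient ≤
β`, and such bounds pass to the infimum. -/
lemma coneM_mem {X Y : Matrix n n ℂ} (hX : X.PosSemidef) (hY : Y.PosSemidef)
    {β : ℝ} (h : (β • Y - X).PosSemidef) :
    (coneM (psdCone n) X Y • Y - X).PosSemidef := by
  rw [posSemidef_smul_sub_iff hX.1 hY.1]
  intro v
  rcases (quadForm_nonneg hY v).eq_or_lt with h0 | h0
  · have := (posSemidef_smul_sub_iff hX.1 hY.1 β).1 h v
    rwa [← h0, mul_zero] at this ⊢
  · rw [← div_le_iff₀ h0]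
    refine le_csInf ⟨β, h⟩ fun b hb => ?_
    rw [div_le_iff₀ h0]
    exact (posSemidef_smul_sub_iff hX.1 hY.1 b).1 hb v

lemma coneEquiv_iff {X Y : Matrix n n ℂ} (hX : X.PosSemidef) (hY : Y.PosSemidef) :
    ConeEquiv (psdCone n) X Y ↔
      (∃ β : ℝ, (β • Y - X).PosSemidef) ∧ ∃ β : ℝ, (β • X - Y).PosSemidef := by
  constructor
  · rintro ⟨⟨a, b, -, h⟩, ⟨c, d, -, h'⟩⟩
    exact ⟨⟨b, h⟩, ⟨d, h'⟩⟩
  · rintro ⟨⟨b, h⟩, ⟨d, h'⟩⟩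
    exact ⟨⟨0, b, by simpa [psdCone] using hX, h⟩, ⟨0, d, by simpa [psdCone] using hY, h'⟩⟩

lemma dH_le_of_comparable {r : ℝ} {X Y : Matrix n n ℂ} (hX : X.PosSemidef) (hY : Y.PosSemidef)
    (h0 : Y ≠ 0) (h : Comparable (Real.exp r) X Y) : dH X Y ≤ (r : EReal) := by
  have hX0 := h.ne_zero hY h0
  obtain ⟨β, β', h1, h2, h3, h4, h5⟩ := h
  rw [dH, hilbertMetric, if_pos ⟨(coneEquiv_iff hX hY).2 ⟨⟨β, h4⟩, ⟨β', h5⟩⟩, h0⟩]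
  rw [EReal.coe_le_coe_iff]
  have m1 := pos_of_smul_sub hX hY hX0 (coneM_mem hX hY h4)
  have m2 := pos_of_smul_sub hY hX h0 (coneM_mem hY hX h5)
  rw [Real.log_le_iff_le_exp (by positivity)]
  exact (mul_le_mul (coneM_le hX hY hX0 h4) (coneM_le hY hX h0 h5) m2.le h1.le).trans h3

lemma exists_dH_eq {t : ℝ} {X Y : Matrix n n ℂ} (hX : X.PosSemidef) (hY : Y.PosSemidef)
    (h0 : Y ≠ 0) (h : Comparable t X Y) :
    ∃ d : ℝ, 0 ≤ d ∧ dH X Y = (d : EReal) ∧ Comparable (Real.exp d) X Y := by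
  have hX0 := h.ne_zero hY h0
  obtain ⟨β, β', h1, h2, h3, h4, h5⟩ := h
  have e1 := coneM_mem hX hY h4
  have e2 := coneM_mem hY hX h5
  have m1 := pos_of_smul_sub hX hY hX0 e1
  have m2 := pos_of_smul_sub hY hX h0 e2
  refine ⟨_, Real.log_nonneg (one_le_of_smul_sub hX hY hX0 m1.le e1 e2), ?_,
    coneM (psdCone n) X Y, coneM (psdCone n) Y X, m1, m2, ?_, e1, e2⟩
  · rw [dH, hilbertMetric, if_pos ⟨(coneEquiv_iff hX hY).2 ⟨⟨β, h4⟩, ⟨β', h5⟩⟩, h0⟩]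
  · rw [Real.exp_log (by positivity)]

end Comparable

/-! ### Strict positivity of the Petz divergence. -/

section TraceInequality

open Matrix

variable {n : Type*} [Fintype n] [DecidableEq n]

/-- `P i j` is the squared overlap of the `i`-th eigenvector of `V` with the `j`-th of `T`. One
weight serves all `f` and `g`, so trace inequalities for noncommuting `V` and `T` reduce to scalar
ones. -/
lemma exists_trace_cfc_mul_cfc {V T : Matrix n n ℂ} (hV : V.PosSemidef) (hT : T.PosSemidef) :
    ∃ (v t : n → ℝ) (P : n → n → ℝ), (∀ i, 0 ≤ v i) ∧ (∀ j, 0 ≤ t j) ∧ (∀ i j, 0 ≤ P i j) ∧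
      ∀ f g : ℝ → ℝ, (cfc f V * cfc g T).trace.re = ∑ i, ∑ j, P i j * (f (v i) * g (t j)) := by
  set U : Matrix n n ℂ := ↑hV.1.eigenvectorUnitary
  set W : Matrix n n ℂ := ↑hT.1.eigenvectorUnitary
  refine ⟨hV.1.eigenvalues, hT.1.eigenvalues, fun i j => Complex.normSq ((star U * W) i j),
    hV.eigenvalues_nonneg, hT.eigenvalues_nonneg, fun i j => Complex.normSq_nonneg _,
    fun f g => ?_⟩
  have hUU : U * star U = 1 := Unitary.coe_mul_star_self _
  have hWW : W * star W = 1 := Unitary.coe_mul_star_self _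
  set D : Matrix n n ℂ := diagonal (fun i => ((f (hV.1.eigenvalues i) : ℝ) : ℂ))
  set E : Matrix n n ℂ := diagonal (fun i => ((g (hT.1.eigenvalues i) : ℝ) : ℂ))
  have h1 : cfc f V = U * D * star U := by
    rw [← cfc_spectral hV.1 f, Matrix.mul_assoc, hUU, Matrix.mul_one]
  have h2 : cfc g T = W * E * star W := by
    rw [← cfc_spectral hT.1 g, Matrix.mul_assoc, hWW, Matrix.mul_one]
  have h3 : (cfc f V * cfc g T).trace = (D * (star U * W) * E * star (star U * W)).trace := by
    rw [h1, h2, star_mul, star_star]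
    simp only [Matrix.mul_assoc]
    rw [Matrix.trace_mul_comm]
    simp only [Matrix.mul_assoc]
  rw [h3]
  simp only [Matrix.trace, Matrix.diag, Matrix.mul_apply (N := star (star U * W)), D, E,
    Matrix.mul_diagonal, Matrix.diagonal_mul, Complex.re_sum, Matrix.star_apply]
  refine Finset.sum_congr rfl fun i _ => Finset.sum_congr rfl fun j _ => ?_
  rw [Complex.normSq_apply]
  generalize (star U * W) i j = z
  simp
  ring

/-- The Bernoulli inequality in homogeneous form, with its equality case. -/
lemma mul_sub_le_rpow_mul {α x t : ℝ} (hα : 1 < α) (hx : 0 ≤ x) (ht : 0 < t) :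
    0 ≤ suppPowFun α x * suppPowFun (1 - α) t - α * x + (α - 1) * t ∧
      (suppPowFun α x * suppPowFun (1 - α) t - α * x + (α - 1) * t = 0 → x = t) := by
  have e : suppPowFun α x * suppPowFun (1 - α) t = t * (1 + (x / t - 1)) ^ α := by
    have h1 : suppPowFun α x = x ^ α := by
      unfold suppPowFun; split_ifs with h
      · rw [h, Real.zero_rpow (by linarith)]
      · rfl
    have h2 : suppPowFun (1 - α) t = t ^ (1 - α) := if_neg ht.ne'
    rw [h1, h2, add_sub_cancel, Real.div_rpow hx ht.le, Real.rpow_sub ht, Real.rpow_one]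
    ring
  rw [e]
  have hs : -1 ≤ x / t - 1 := by linarith [div_nonneg hx ht.le]
  have e2 : t * (x / t) = x := mul_div_cancel₀ x ht.ne'
  by_cases h0 : x / t - 1 = 0
  · have hxt : x = t := by rw [← e2, sub_eq_zero.1 h0, mul_one]
    subst hxt
    rw [h0, add_zero, Real.one_rpow]
    exact ⟨by linarith, fun _ => rfl⟩
  · have := mul_lt_mul_of_pos_left (one_add_mul_self_lt_rpow_one_add hs h0 hα) ht
    have e3 : t * (1 + α * (x / t - 1)) = t + α * x - α * t := by
      linear_combination α * e2
    rw [e3] at this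
    exact ⟨by linarith, fun h => by linarith⟩

/-- The Petz divergence of two states vanishes only if they are equal. -/
lemma eq_of_trace_suppPow_le_one {α : ℝ} (hα : 1 < α) {V T : Matrix n n ℂ} (hV : V.PosSemidef)
    (hT : T.PosSemidef) (hV1 : V.trace = 1) (hT1 : T.trace = 1) (hs : V * suppPow T 0 = V)
    (h : (suppPow V α * suppPow T (1 - α)).trace.re ≤ 1) : V = T := by
  obtain ⟨v, t, P, hv, ht, hP, key⟩ := exists_trace_cfc_mul_cfc hV hT
  have idV : cfc (fun x : ℝ => x) V = V := cfc_id' ℝ V hV.1.isSelfAdjoint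
  have idT : cfc (fun x : ℝ => x) T = T := cfc_id' ℝ T hT.1.isSelfAdjoint
  have oneV : cfc (fun _ : ℝ => (1 : ℝ)) V = 1 := cfc_const_one ℝ V hV.1.isSelfAdjoint
  have oneT : cfc (fun _ : ℝ => (1 : ℝ)) T = 1 := cfc_const_one ℝ T hT.1.isSelfAdjoint
  have sqV : cfc (fun x : ℝ => x * x) V = V * V := by
    rw [cfc_mul _ _ V (continuousOn_spectrum V _) (continuousOn_spectrum V _), idV]
  have sqT : cfc (fun x : ℝ => x * x) T = T * T := by
    rw [cfc_mul _ _ T (continuousOn_spectrum T _) (continuousOn_spectrum T _), idT]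
  have k1 := key (fun x => x) (fun _ => 1)
  have k2 := key (fun _ => 1) (fun x => x)
  have k3 := key (fun x => x) (suppPowFun 0)
  have k4 := key (suppPowFun α) (suppPowFun (1 - α))
  have k5 := key (fun x => x * x) (fun _ => 1)
  have k6 := key (fun _ => 1) (fun x => x * x)
  have k7 := key (fun x => x) (fun x => x)
  rw [idV, oneT, Matrix.mul_one, hV1, Complex.one_re] at k1
  rw [idT, oneV, Matrix.one_mul, hT1, Complex.one_re] at k2
  rw [idV, ← suppPow_eq, hs, hV1, Complex.one_re] at k3
  rw [← suppPow_eq, ← suppPow_eq] at k4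
  rw [sqV, oneT, Matrix.mul_one] at k5
  rw [sqT, oneV, Matrix.one_mul] at k6
  rw [idV, idT] at k7
  -- Classical absolute continuity: since `tr V = tr[V T^0]`, no weight of `V` sits on zero
  -- eigenvalues of `T`.
  have hz : ∀ i j, t j = 0 → P i j * v i = 0 := by
    have hsum : ∑ i, ∑ j, P i j * (v i * (1 - suppPowFun 0 (t j))) = 0 := by
      have : ∀ i j, P i j * (v i * (1 - suppPowFun 0 (t j))) =
          P i j * (v i * 1) - P i j * (v i * suppPowFun 0 (t j)) := fun i j => by ring
      simp only [this, Finset.sum_sub_distrib, ← k1, ← k3, sub_self]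
    have hnn : ∀ i j, 0 ≤ P i j * (v i * (1 - suppPowFun 0 (t j))) := by
      intro i j
      have : suppPowFun 0 (t j) ≤ 1 := by unfold suppPowFun; split_ifs <;> simp
      exact mul_nonneg (hP i j) (mul_nonneg (hv i) (by linarith))
    intro i j h0
    rw [Finset.sum_eq_zero_iff_of_nonneg fun i _ => Finset.sum_nonneg fun j _ => hnn i j] at hsum
    have h1 := hsum i (Finset.mem_univ i)
    rw [Finset.sum_eq_zero_iff_of_nonneg fun j _ => hnn i j] at h1
    simpa [h0] using h1 j (Finset.mem_univ j)
  -- The weighted Bernoulli gap. It is nonnegative termwise, and its total is `tr[V^α T^(1-α)] - α +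
  -- (α - 1) ≤ 0`, so every term vanishes.
  set φ : n → n → ℝ := fun i j =>
    P i j * (suppPowFun α (v i) * suppPowFun (1 - α) (t j) - α * v i + (α - 1) * t j) with hφ
  have hφ0 : ∀ i j, 0 ≤ φ i j := by
    intro i j
    rcases (ht j).eq_or_lt with h0 | h0
    · have h1 := hz i j h0.symm
      have : φ i j = -α * (P i j * v i) := by simp only [hφ, ← h0, suppPowFun_zero]; ring
      rw [this, h1, mul_zero]
    · exact mul_nonneg (hP i j) (mul_sub_le_rpow_mul hα (hv i) h0).1
  have hsum : ∑ i, ∑ j, φ i j = 0 := by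
    refine le_antisymm ?_ (Finset.sum_nonneg fun i _ => Finset.sum_nonneg fun j _ => hφ0 i j)
    have : ∀ i j, φ i j = P i j * (suppPowFun α (v i) * suppPowFun (1 - α) (t j)) -
        α * (P i j * (v i * 1)) + (α - 1) * (P i j * (1 * t j)) := fun i j => by
      simp only [hφ]; ring
    simp only [this, Finset.sum_add_distrib, Finset.sum_sub_distrib, ← Finset.mul_sum, ← k1, ← k2,
      ← k4]
    linarith
  have heq : ∀ i j, P i j * ((v i - t j) * (v i - t j)) = 0 := by
    rw [Finset.sum_eq_zero_iff_of_nonneg fun i _ => Finset.sum_nonneg fun j _ => hφ0 i j] at hsum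
    intro i j
    have h1 := hsum i (Finset.mem_univ i)
    rw [Finset.sum_eq_zero_iff_of_nonneg fun j _ => hφ0 i j] at h1
    have h2 := h1 j (Finset.mem_univ j)
    rcases (ht j).eq_or_lt with h0 | h0
    · have h3 := hz i j h0.symm
      rw [← h0, sub_zero, ← mul_assoc, h3, zero_mul]
    · rcases mul_eq_zero.1 h2 with h3 | h3
      · rw [h3, zero_mul]
      · rw [(mul_sub_le_rpow_mul hα (hv i) h0).2 h3]; ring
  -- The squared Hilbert–Schmidt distance equals the sum of `P i j * (v i - t j)^2`.
  have hHS : ((V - T)ᴴ * (V - T)).trace.re = 0 := by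
    rw [Matrix.conjTranspose_sub, hV.1.eq, hT.1.eq, Matrix.sub_mul, Matrix.mul_sub, Matrix.mul_sub,
      Matrix.trace_sub, Matrix.trace_sub, Matrix.trace_sub, Matrix.trace_mul_comm T V]
    simp only [Complex.sub_re, k5, k6, k7]
    simp only [← Finset.sum_sub_distrib]
    refine Finset.sum_eq_zero fun i _ => Finset.sum_eq_zero fun j _ => ?_
    linear_combination heq i j
  have h0 := (Matrix.posSemidef_conjTranspose_mul_self (V - T)).trace_nonneg
  rw [← sub_eq_zero, ← Matrix.trace_conjTranspose_mul_self_eq_zero_iff]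
  exact Complex.ext hHS (Complex.le_def.1 h0).2.symm

end TraceInequality

/-! ### Partial traces, the linear part of the update, and exchange of the factors. -/

section Contract

open Matrix

set_option linter.unusedSectionVars false

variable {a b : Type*} [Fintype a] [DecidableEq a] [Fintype b] [DecidableEq b]

/-- The linear map `X ↦ tr_A[Z (X ⊗ 1)]`. -/
def contract (Z : Matrix (a × b) (a × b) ℂ) : Matrix a a ℂ →ₗ[ℝ] Matrix b b ℂ where
  toFun X := trA (Z * (X ⊗ₖ (1 : Matrix b b ℂ)))
  map_add' X Y := by
    rw [Matrix.add_kronecker, Matrix.mul_add]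
    ext j j'
    simp [trA, Finset.sum_add_distrib]
  map_smul' c X := by
    rw [Matrix.smul_kronecker, Matrix.mul_smul]
    ext j j'
    simp [trA, Finset.mul_sum]

lemma contract_apply (Z : Matrix (a × b) (a × b) ℂ) (X : Matrix a a ℂ) :
    contract Z X = trA (Z * (X ⊗ₖ (1 : Matrix b b ℂ))) := rfl

lemma contract_one (Z : Matrix (a × b) (a × b) ℂ) : contract Z 1 = trA Z := by
  rw [contract_apply, Matrix.one_kronecker_one, Matrix.mul_one]

lemma trace_trA (M : Matrix (a × b) (a × b) ℂ) : (trA M).trace = M.trace := by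
  simp only [Matrix.trace, Matrix.diag, trA, Matrix.of_apply, Fintype.sum_prod_type]
  exact Finset.sum_comm

lemma trA_mul_one_kronecker (M : Matrix (a × b) (a × b) ℂ) (Y : Matrix b b ℂ) :
    trA (M * ((1 : Matrix a a ℂ) ⊗ₖ Y)) = trA M * Y := by
  ext j j'
  simp only [trA, Matrix.of_apply, Matrix.mul_apply, Fintype.sum_prod_type,
    Matrix.kroneckerMap_apply, Matrix.one_apply, ite_mul, one_mul, zero_mul, mul_ite, mul_zero,
    Finset.sum_mul]
  rw [Finset.sum_comm]
  conv_rhs => rw [Finset.sum_comm]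
  refine Finset.sum_congr rfl fun i _ => ?_
  rw [Finset.sum_comm]
  simp

lemma kronecker_eq_left_mul_right (X : Matrix a a ℂ) (Y : Matrix b b ℂ) :
    X ⊗ₖ Y = (X ⊗ₖ (1 : Matrix b b ℂ)) * ((1 : Matrix a a ℂ) ⊗ₖ Y) := by
  rw [← Matrix.mul_kronecker_mul, Matrix.mul_one, Matrix.one_mul]

lemma kronecker_eq_right_mul_left (X : Matrix a a ℂ) (Y : Matrix b b ℂ) :
    X ⊗ₖ Y = ((1 : Matrix a a ℂ) ⊗ₖ Y) * (X ⊗ₖ (1 : Matrix b b ℂ)) := by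
  rw [← Matrix.mul_kronecker_mul, Matrix.mul_one, Matrix.one_mul]

lemma trace_mul_kronecker (Z : Matrix (a × b) (a × b) ℂ) (X : Matrix a a ℂ) (Y : Matrix b b ℂ) :
    (Z * (X ⊗ₖ Y)).trace = (contract Z X * Y).trace := by
  rw [contract_apply, ← trA_mul_one_kronecker, trace_trA, kronecker_eq_left_mul_right,
    Matrix.mul_assoc]

/-- The product vector `φ ⊗ v`. -/
def tensorVec (φ : a → ℂ) (v : b → ℂ) : a × b → ℂ := fun p => φ p.1 * v p.2

lemma sandwich_eq (Z : Matrix (a × b) (a × b) ℂ) (φ : EuclideanSpace ℂ a) :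
    sandwich Z φ =
      (Matrix.of fun (p : a × b) (j : b) => φ p.1 * (1 : Matrix b b ℂ) p.2 j)ᴴ * Z *
        Matrix.of fun (p : a × b) (j : b) => φ p.1 * (1 : Matrix b b ℂ) p.2 j := by
  ext j j'
  simp only [sandwich, Matrix.of_apply, Matrix.mul_apply, Fintype.sum_prod_type,
    Matrix.conjTranspose_apply, Matrix.one_apply, mul_ite, mul_one, mul_zero,
    apply_ite star, star_zero, ite_mul, zero_mul, Finset.sum_ite_eq', Finset.mem_univ, if_true,
    Finset.sum_mul]
  exact Finset.sum_comm

lemma quadForm_sandwich (Z : Matrix (a × b) (a × b) ℂ) (φ : EuclideanSpace ℂ a) (v : b → ℂ) :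
    quadForm (sandwich Z φ) v = quadForm Z (tensorVec φ.ofLp v) := by
  set K : Matrix (a × b) b ℂ := Matrix.of fun p j => φ p.1 * (1 : Matrix b b ℂ) p.2 j with hK
  have hKv : K *ᵥ v = tensorVec φ.ofLp v := by
    funext p
    simp [K, tensorVec, Matrix.mulVec, dotProduct, Matrix.one_apply]
  rw [sandwich_eq, ← hK, ← hKv, quadForm, quadForm, ← Matrix.mulVec_mulVec, ← Matrix.mulVec_mulVec,
    Matrix.dotProduct_mulVec, Matrix.star_mulVec]

lemma posSemidef_sandwich {Z : Matrix (a × b) (a × b) ℂ} (hZ : Z.PosSemidef)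
    (φ : EuclideanSpace ℂ a) : (sandwich Z φ).PosSemidef := by
  rw [sandwich_eq]
  exact hZ.conjTranspose_mul_mul_same _

/-- Decomposes a positive argument into rank-one pieces. Positivity and cross-ratio bounds for
`contract Z` thereby reduce to product vectors. -/
lemma contract_conjTranspose_mul_self (Z : Matrix (a × b) (a × b) ℂ) (D : Matrix a a ℂ) :
    contract Z (Dᴴ * D) = ∑ l, sandwich Z (WithLp.toLp 2 fun i => star (D l i)) := by
  ext j j'
  simp only [contract_apply, trA, sandwich, Matrix.of_apply, Matrix.sum_apply, Matrix.mul_apply,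
    Fintype.sum_prod_type, Matrix.kroneckerMap_apply, Matrix.one_apply, Matrix.conjTranspose_apply,
    star_star, mul_ite, mul_one, mul_zero, Finset.sum_ite_eq', Finset.mem_univ, if_true]
  simp only [Finset.mul_sum]
  conv_rhs => rw [Finset.sum_comm]
  refine Finset.sum_congr rfl fun i _ => ?_
  rw [Finset.sum_comm]
  refine Finset.sum_congr rfl fun l _ => Finset.sum_congr rfl fun k _ => ?_
  ring

lemma posSemidef_contract {Z : Matrix (a × b) (a × b) ℂ} (hZ : Z.PosSemidef) {X : Matrix a a ℂ}
    (hX : X.PosSemidef) : (contract Z X).PosSemidef := by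
  obtain ⟨D, rfl⟩ := exists_eq_conjTranspose_mul_self hX
  rw [contract_conjTranspose_mul_self]
  exact Matrix.posSemidef_sum _ fun l _ => posSemidef_sandwich hZ _

/-- Exchange of the two tensor factors. -/
def swap (Z : Matrix (a × b) (a × b) ℂ) : Matrix (b × a) (b × a) ℂ :=
  Z.submatrix Prod.swap Prod.swap

lemma swap_mul (M N : Matrix (a × b) (a × b) ℂ) : swap (M * N) = swap M * swap N :=
  (Matrix.submatrix_mul_equiv M N Prod.swap (Equiv.prodComm b a) Prod.swap).symm

lemma swap_kronecker (X : Matrix a a ℂ) (Y : Matrix b b ℂ) : swap (X ⊗ₖ Y) = Y ⊗ₖ X := by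
  ext p q
  simp [swap, mul_comm]

lemma swap_swap (Z : Matrix (a × b) (a × b) ℂ) : swap (swap Z) = Z := by
  ext p q; simp [swap]

lemma trB_eq_trA_swap (Z : Matrix (a × b) (a × b) ℂ) : trB Z = trA (swap Z) := by
  ext i i'; simp [trA, trB, swap]

lemma trace_swap (Z : Matrix (a × b) (a × b) ℂ) : (swap Z).trace = Z.trace := by
  simp only [Matrix.trace, Matrix.diag, swap, Matrix.submatrix_apply]
  exact Equiv.sum_comp (Equiv.prodComm b a) fun p => Z p p

lemma posSemidef_swap {Z : Matrix (a × b) (a × b) ℂ} (hZ : Z.PosSemidef) : (swap Z).PosSemidef :=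
  hZ.submatrix _

lemma NAB_eq (α : ℝ) (ρ : Matrix (a × b) (a × b) ℂ) (σ : Matrix a a ℂ) :
    NAB α ρ σ =
      normalize (suppPow (contract (suppPow ρ α) (suppPow σ (1 - α))) (1 / α)) := rfl

lemma NBA_eq (α : ℝ) (ρ : Matrix (a × b) (a × b) ℂ) (τ : Matrix b b ℂ) :
    NBA α ρ τ =
      normalize (suppPow (contract (swap (suppPow ρ α)) (suppPow τ (1 - α))) (1 / α)) := by
  rw [NBA, trB_eq_trA_swap, swap_mul, swap_kronecker, contract_apply]

end Contract

/-! ### Minimizers as fixed points, and the support of fixed points. -/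

section FixedPoint

open Matrix

set_option linter.unusedSectionVars false

variable {n : Type*} [Fintype n] [DecidableEq n]

lemma suppPow_zero_matrix (p : ℝ) : suppPow (0 : Matrix n n ℂ) p = 0 := by
  have := suppPow_mul_self (Matrix.PosSemidef.zero (n := n) (R := ℂ)) (p - 1)
  rwa [Matrix.mul_zero, sub_add_cancel, eq_comm] at this

lemma suppPow_eq_zero_iff {X : Matrix n n ℂ} (hX : X.PosSemidef) {p : ℝ} (hp : p ≠ 0) :
    suppPow X p = 0 ↔ X = 0 := by
  refine ⟨fun h => ?_, fun h => by rw [h, suppPow_zero_matrix]⟩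
  rw [← suppPow_one hX, ← mul_inv_cancel₀ hp, ← suppPow_suppPow hX, h, suppPow_zero_matrix]

lemma suppPow_one_matrix (p : ℝ) : suppPow (1 : Matrix n n ℂ) p = 1 := by
  rw [suppPow_eq, ← map_one (algebraMap ℝ (Matrix n n ℂ)), cfc_algebraMap]
  simp [suppPowFun]

lemma one_sub_supp_mul_self {X : Matrix n n ℂ} (hX : X.PosSemidef) :
    (1 - suppPow X 0) * (1 - suppPow X 0) = 1 - suppPow X 0 := by
  have : suppPow X 0 * suppPow X 0 = suppPow X 0 := by rw [suppPow_mul_suppPow hX, zero_add]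
  rw [Matrix.sub_mul, Matrix.mul_sub, Matrix.mul_sub, this]
  simp

lemma posSemidef_one_sub_supp {X : Matrix n n ℂ} (hX : X.PosSemidef) :
    (1 - suppPow X 0).PosSemidef := by
  have h := Matrix.posSemidef_conjTranspose_mul_self (1 - suppPow X 0)
  rwa [Matrix.conjTranspose_sub, Matrix.conjTranspose_one, (isHermitian_suppPow X 0).eq,
    one_sub_supp_mul_self hX] at h

lemma normalize_eq {X : Matrix n n ℂ} (hX : X.PosSemidef) :
    normalize X = (X.trace.re)⁻¹ • X := by
  have : X.trace = (X.trace.re : ℂ) :=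
    Complex.ext rfl (Complex.le_def.1 hX.trace_nonneg).2.symm
  rw [normalize, this]
  ext i j
  simp [Matrix.smul_apply]

lemma trace_re_pos {X : Matrix n n ℂ} (hX : X.PosSemidef) (h : X ≠ 0) : 0 < X.trace.re := by
  have h1 := Complex.le_def.1 hX.trace_nonneg
  refine lt_of_le_of_ne h1.1 fun h2 => h (hX.trace_eq_zero_iff.1 ?_)
  exact Complex.ext h2.symm h1.2.symm

lemma isState_normalize {X : Matrix n n ℂ} (hX : X.PosSemidef) (h : X ≠ 0) :
    IsState (normalize X) := by
  refine ⟨?_, ?_⟩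
  · rw [normalize_eq hX]
    exact hX.smul (inv_nonneg.2 (trace_re_pos hX h).le)
  · rw [normalize, Matrix.trace_smul, smul_eq_mul, inv_mul_cancel₀]
    exact fun h' => h (hX.trace_eq_zero_iff.1 h')

variable {a b : Type*} [Fintype a] [DecidableEq a] [Fintype b] [DecidableEq b]

lemma contract_mul_of_mul {Z : Matrix (a × b) (a × b) ℂ} {R : Matrix b b ℂ}
    (h : Z * ((1 : Matrix a a ℂ) ⊗ₖ R) = Z) (X : Matrix a a ℂ) :
    contract Z X * R = contract Z X := by
  rw [contract_apply, ← trA_mul_one_kronecker, Matrix.mul_assoc, ← kronecker_eq_left_mul_right,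
    kronecker_eq_right_mul_left, ← Matrix.mul_assoc, h]

/-- For `Q` the kernel projection of `contract Z X`, `tr[Z (X ⊗ Q)] = tr[contract Z X * Q] = 0`.
Both factors being positive, `Z (X ⊗ Q) = 0`, and `X` is cancelled by its inverse on the support. -/
lemma mul_supp_contract {Z : Matrix (a × b) (a × b) ℂ} (hZ : Z.PosSemidef) {X : Matrix a a ℂ}
    (hX : X.PosSemidef) (h : Z * (suppPow X 0 ⊗ₖ (1 : Matrix b b ℂ)) = Z) :
    Z * ((1 : Matrix a a ℂ) ⊗ₖ suppPow (contract Z X) 0) = Z := by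
  have hW := posSemidef_contract hZ hX
  set Q := 1 - suppPow (contract Z X) 0 with hQ
  have hQp : Q.PosSemidef := posSemidef_one_sub_supp hW
  have h1 : Z * (X ⊗ₖ Q) = 0 := by
    refine mul_eq_zero_of_trace_mul hZ (hX.kronecker hQp) ?_
    rw [trace_mul_kronecker, mul_one_sub_supp hW, Matrix.trace_zero]
  have h2 : Z * ((1 : Matrix a a ℂ) ⊗ₖ Q) = 0 := by
    rw [← h, Matrix.mul_assoc, ← kronecker_eq_left_mul_right, ← neg_add_cancel (1 : ℝ),
      add_comm (-1 : ℝ), ← suppPow_mul_suppPow hX, suppPow_one hX, ← Matrix.mul_one Q,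
      Matrix.mul_kronecker_mul, ← Matrix.mul_assoc, h1, Matrix.zero_mul]
  have h3 : (1 : Matrix a a ℂ) ⊗ₖ suppPow (contract Z X) 0 = 1 - (1 : Matrix a a ℂ) ⊗ₖ Q := by
    rw [eq_sub_iff_add_eq, ← Matrix.kronecker_add, hQ, add_sub_cancel, Matrix.one_kronecker_one]
  rw [h3, Matrix.mul_sub, h2, Matrix.mul_one, sub_zero]

lemma mul_one_kronecker_of_mul_kronecker {Z : Matrix (a × b) (a × b) ℂ} {P : Matrix a a ℂ}
    {R : Matrix b b ℂ} (h : Z * (P ⊗ₖ R) = Z) (hR : R * R = R) :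
    Z * ((1 : Matrix a a ℂ) ⊗ₖ R) = Z := by
  conv_lhs => rw [← h]
  rw [Matrix.mul_assoc, ← Matrix.mul_kronecker_mul, Matrix.mul_one, hR, h]

lemma mul_kronecker_one_of_mul_kronecker {Z : Matrix (a × b) (a × b) ℂ} {P : Matrix a a ℂ}
    {R : Matrix b b ℂ} (h : Z * (P ⊗ₖ R) = Z) (hP : P * P = P) :
    Z * (P ⊗ₖ (1 : Matrix b b ℂ)) = Z := by
  conv_lhs => rw [← h]
  rw [Matrix.mul_assoc, ← Matrix.mul_kronecker_mul, Matrix.mul_one, hP, h]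

lemma supp_mul_supp {X : Matrix n n ℂ} (hX : X.PosSemidef) :
    suppPow X 0 * suppPow X 0 = suppPow X 0 := by
  rw [suppPow_mul_suppPow hX, zero_add]

lemma contract_ne_zero {Z : Matrix (a × b) (a × b) ℂ} (hZ : Z.PosSemidef) (hZ0 : Z ≠ 0)
    {X : Matrix a a ℂ} (hX : X.PosSemidef)
    (h : Z * (suppPow X 0 ⊗ₖ (1 : Matrix b b ℂ)) = Z) : contract Z X ≠ 0 := by
  intro h0
  have := mul_supp_contract hZ hX h
  rw [h0, suppPow_zero_matrix, Matrix.kronecker_zero, Matrix.mul_zero] at this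
  exact hZ0 this.symm

/-- A minimizer over the second argument is a fixed point of the update map. -/
lemma eq_normalize_of_minimizer {α : ℝ} (hα : 1 < α) {Z : Matrix (a × b) (a × b) ℂ}
    (hZ : Z.PosSemidef) (hZ0 : Z ≠ 0) {σ : Matrix a a ℂ} {τ : Matrix b b ℂ} (hσ : σ.PosSemidef)
    (hτ : IsState τ) (hs : Z * (suppPow σ 0 ⊗ₖ suppPow τ 0) = Z)
    (hmin : ∀ τ', IsState τ' → Z * (suppPow σ 0 ⊗ₖ suppPow τ' 0) = Z →
      (Z * (suppPow σ (1 - α) ⊗ₖ suppPow τ (1 - α))).trace.re ≤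
      (Z * (suppPow σ (1 - α) ⊗ₖ suppPow τ' (1 - α))).trace.re) :
    τ = normalize (suppPow (contract Z (suppPow σ (1 - α))) (1 / α)) := by
  have hα0 : α ≠ 0 := by linarith
  have hσp := posSemidef_suppPow hσ (1 - α)
  have hsσ := mul_kronecker_one_of_mul_kronecker hs (supp_mul_supp hσ)
  have hsτ := mul_one_kronecker_of_mul_kronecker hs (supp_mul_supp hτ.1)
  have hsσ' : Z * (suppPow (suppPow σ (1 - α)) 0 ⊗ₖ (1 : Matrix b b ℂ)) = Z := by
    rwa [suppPow_suppPow hσ, mul_zero]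
  set W := contract Z (suppPow σ (1 - α)) with hW
  have hWp : W.PosSemidef := posSemidef_contract hZ hσp
  have hZW : Z * ((1 : Matrix a a ℂ) ⊗ₖ suppPow W 0) = Z := mul_supp_contract hZ hσp hsσ'
  have hW0 : W ≠ 0 := contract_ne_zero hZ hZ0 hσp hsσ'
  set S := suppPow W (1 / α) with hS
  have hSp : S.PosSemidef := posSemidef_suppPow hWp _
  have hS0 : S ≠ 0 := by rwa [hS, Ne, suppPow_eq_zero_iff hWp (by positivity)]
  have hV : IsState (normalize S) := isState_normalize hSp hS0
  set c := S.trace.re with hc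
  have hcpos : 0 < c := trace_re_pos hSp hS0
  have hcV : normalize S = c⁻¹ • S := normalize_eq hSp
  have hVp : ∀ p, suppPow (normalize S) p = (c⁻¹ ^ p) • suppPow W (1 / α * p) := by
    intro p
    rw [hcV, suppPow_smul hSp (inv_pos.2 hcpos), hS, suppPow_suppPow hWp]
  have hV0 : suppPow (normalize S) 0 = suppPow W 0 := by
    rw [hVp, Real.rpow_zero, one_smul, mul_zero]
  have hWτ : W * suppPow τ 0 = W := contract_mul_of_mul hsτ _
  have hVτ : normalize S * suppPow τ 0 = normalize S := by
    rw [hcV, Matrix.smul_mul]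
    congr 1
    have : S = suppPow W (1 / α - 1) * W := by rw [suppPow_mul_self hWp, sub_add_cancel]
    rw [this, Matrix.mul_assoc, hWτ]
  have hZV : Z * (suppPow σ 0 ⊗ₖ suppPow (normalize S) 0) = Z := by
    rw [hV0, kronecker_eq_left_mul_right, ← Matrix.mul_assoc, hsσ, hZW]
  -- The competitor is `V = c⁻¹ W^(1/α)`, for which `tr[W V^(1-α)] = c^α`. As `V^α = c^(-α) W`,
  -- minimality of `τ` becomes `tr[V^α τ^(1-α)] ≤ 1`.
  have h1 := hmin _ hV hZV
  rw [trace_mul_kronecker, trace_mul_kronecker, ← hW, hVp, Matrix.mul_smul,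
    self_mul_suppPow hWp, Matrix.trace_smul, Complex.smul_re, smul_eq_mul] at h1
  have e1 : 1 / α * (1 - α) + 1 = 1 / α := by field_simp; ring
  rw [e1, ← hS, ← hc] at h1
  refine (eq_of_trace_suppPow_le_one hα hV.1 hτ.1 hV.2 hτ.2 hVτ ?_).symm
  rw [hVp, one_div_mul_cancel hα0, suppPow_one hWp, Matrix.smul_mul, Matrix.trace_smul,
    Complex.smul_re, smul_eq_mul]
  calc c⁻¹ ^ α * (W * suppPow τ (1 - α)).trace.re
      ≤ c⁻¹ ^ α * (c⁻¹ ^ (1 - α) * c) := by gcongr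
    _ = 1 := by
      rw [← mul_assoc, ← Real.rpow_add (inv_pos.2 hcpos), add_sub_cancel, Real.rpow_one,
        inv_mul_cancel₀ hcpos.ne']

/-- A fixed point of the update map has the support of the marginal. -/
lemma supp_normalize_contract {α : ℝ} (hα : 1 < α) {Z R A B : Matrix (a × b) (a × b) ℂ}
    (hZ : Z.PosSemidef) (hR : R.PosSemidef) (hZR : Z = A * R) (hRZ : R = B * Z) (hZ0 : Z ≠ 0)
    {X : Matrix a a ℂ} (hX : X.PosSemidef)
    (hs : Z * (suppPow X 0 ⊗ₖ (1 : Matrix b b ℂ)) = Z) :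
    suppPow (normalize (suppPow (contract Z X) (1 / α))) 0 = suppPow (trA R) 0 := by
  have hW := posSemidef_contract hZ hX
  have hW0 := contract_ne_zero hZ hZ0 hX hs
  have hα0 : 1 / α ≠ 0 := by positivity
  have hSp := posSemidef_suppPow hW (1 / α)
  have hS0 : suppPow (contract Z X) (1 / α) ≠ 0 := by rwa [Ne, suppPow_eq_zero_iff hW hα0]
  rw [normalize_eq hSp, suppPow_zero_smul hSp (inv_pos.2 (trace_re_pos hSp hS0)),
    suppPow_suppPow hW, mul_zero, ← contract_one]
  have h1 : R * ((1 : Matrix a a ℂ) ⊗ₖ suppPow (contract R 1) 0) = R := by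
    refine mul_supp_contract hR Matrix.PosSemidef.one ?_
    rw [suppPow_one_matrix, Matrix.one_kronecker_one, Matrix.mul_one]
  -- `Z` and `R` are left multiples of each other, so they absorb the same right factors. In the
  -- application they are `ρ^α` and `ρ`, up to `swap`.
  refine supp_eq_of_mul_supp_eq hW (posSemidef_contract hR Matrix.PosSemidef.one)
    (contract_mul_of_mul ?_ X) (contract_mul_of_mul ?_ 1)
  · conv_lhs => rw [hZR, Matrix.mul_assoc, h1, ← hZR]
  · conv_lhs => rw [hRZ, Matrix.mul_assoc, mul_supp_contract hZ hX hs, ← hRZ]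

end FixedPoint

/-! ### The Birkhoff–Hopf contraction ratio from cross-ratios. -/

section Birkhoff

open Matrix

set_option linter.unusedSectionVars false

variable {n a b : Type*} [Fintype n] [DecidableEq n] [Fintype a] [DecidableEq a] [Fintype b]
  [DecidableEq b]

/-- The scalar core of the contraction theorem. Right side minus left side factors as `s ^ 2 - 1`
times the expression in `hE`, which is nonnegative by the cross-ratio hypothesis `x ≤ k * y` and the
arithmetic-geometric mean inequality `ham`. -/
lemma mul_mul_le_of_cross_ratio {s k p q r w : ℝ} (hs : 1 ≤ s) (hk : 1 ≤ k) (hp : 0 ≤ p)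
    (hq : 0 ≤ q) (hr : 0 ≤ r) (hw : 0 ≤ w) (h : p * w ≤ k ^ 2 * (q * r)) :
    (s ^ 2 * p + q) * (r + w) * (k + s) ^ 2 ≤ (s * k + 1) ^ 2 * ((p + q) * (s ^ 2 * r + w)) := by
  set x := √(p * w) with hx
  set y := √(q * r) with hy
  have hx2 : x ^ 2 = p * w := Real.sq_sqrt (by positivity)
  have hy2 : y ^ 2 = q * r := Real.sq_sqrt (by positivity)
  have hx0 : 0 ≤ x := Real.sqrt_nonneg _
  have hy0 : 0 ≤ y := Real.sqrt_nonneg _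
  have hxy : x ≤ k * y := by
    refine le_of_sq_le_sq ?_ (by positivity)
    rw [mul_pow, hx2, hy2]; exact h
  have ham : 2 * s * (x * y) ≤ s ^ 2 * (p * r) + q * w := by
    refine le_of_sq_le_sq ?_ (by positivity)
    have : (2 * s * (x * y)) ^ 2 = 4 * (s ^ 2 * (p * r)) * (q * w) := by
      rw [mul_pow, mul_pow x y, hx2, hy2]; ring
    rw [this]
    nlinarith [sq_nonneg (s ^ 2 * (p * r) - q * w)]
  have hE : 0 ≤ (k ^ 2 - 1) * (s ^ 2 * (p * r) + q * w) + k * (s ^ 2 * k + 2 * s + k) * (q * r) -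
      (2 * s * k + 1 + s ^ 2) * (p * w) := by
    have h1 : 0 ≤ (k * y - x) * ((s ^ 2 * k + 2 * s + k) * y + (2 * s * k + 1 + s ^ 2) * x) :=
      mul_nonneg (by linarith) (by positivity)
    have h2 : 0 ≤ (k ^ 2 - 1) * (s ^ 2 * (p * r) + q * w - 2 * s * (x * y)) :=
      mul_nonneg (by nlinarith) (by linarith)
    rw [← hx2, ← hy2]
    nlinarith [h1, h2]
  have hs2 : 0 ≤ s ^ 2 - 1 := by nlinarith
  have := mul_nonneg hs2 hE
  nlinarith [this]

/-- The estimate behind the contraction ratio `tanh (δ / 4)`. -/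
lemma div_le_rpow {s k : ℝ} (hs : 1 ≤ s) (hk : 1 ≤ k) :
    (s * k + 1) / (k + s) ≤ s ^ ((k - 1) / (k + 1)) := by
  set c := (k - 1) / (k + 1) with hc
  -- Logarithm of right side over left side, as a function of `s`. It vanishes at `1`, and its
  -- derivative has numerator `(k - 1) * k * (x - 1) ^ 2`.
  set h : ℝ → ℝ := fun x => c * Real.log x - Real.log (x * k + 1) + Real.log (k + x) with hh
  have hd : ∀ x : ℝ, 1 ≤ x → HasDerivAt h (c * x⁻¹ - k / (x * k + 1) + 1 / (k + x)) x := by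
    intro x hx
    have h1 := (Real.hasDerivAt_log (by positivity : x ≠ 0)).const_mul c
    have h2 : HasDerivAt (fun x : ℝ => x * k + 1) k x := by
      simpa using ((hasDerivAt_id x).mul_const k).add_const 1
    have h3 : HasDerivAt (fun x : ℝ => k + x) 1 x := (hasDerivAt_id x).const_add k
    exact (h1.sub (h2.log (by positivity))).add (h3.log (by positivity))
  have hmono : MonotoneOn h (Set.Ici 1) := by
    refine monotoneOn_of_deriv_nonneg (convex_Ici 1)
      (fun x hx => (hd x hx).continuousAt.continuousWithinAt)
      (fun x hx => (hd x (interior_subset hx)).differentiableAt.differentiableWithinAt)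
      fun x hx => ?_
    have hx1 : (1 : ℝ) ≤ x := interior_subset hx
    rw [(hd x hx1).deriv, hc]
    have e : (k - 1) / (k + 1) * x⁻¹ - k / (x * k + 1) + 1 / (k + x) =
        (k - 1) * (k * (x - 1) ^ 2) / ((k + 1) * x * (x * k + 1) * (k + x)) := by
      field_simp
      ring
    rw [e]
    exact div_nonneg (mul_nonneg (by linarith) (by positivity)) (by positivity)
  have h1 : h 1 = 0 := by simp [hh]
  have h2 : 0 ≤ h s := h1 ▸ hmono (Set.mem_Ici.2 le_rfl) (Set.mem_Ici.2 hs) hs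
  have hs0 : 0 < s := by linarith
  rw [← Real.log_le_log_iff (by positivity) (by positivity), Real.log_rpow hs0,
    Real.log_div (by positivity) (by positivity)]
  simp only [hh] at h2
  linarith

lemma sq_div_le_rpow {s k : ℝ} (hs : 1 ≤ s) (hk : 1 ≤ k) :
    ((s * k + 1) / (k + s)) ^ 2 ≤ (s ^ 2) ^ ((k - 1) / (k + 1)) := by
  have hs0 : 0 ≤ s := by linarith
  rw [← Real.rpow_natCast s 2, ← Real.rpow_mul hs0, mul_comm (((2 : ℕ)) : ℝ), Real.rpow_mul hs0, Real.rpow_natCast]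
  exact pow_le_pow_left₀ (by positivity) (div_le_rpow hs hk) 2

/-- The product of the two infima is the supremum of the cross-ratios over `v` and `w`; the
minimality of `coneM` is used once for each vector, with vanishing forms treated apart. -/
lemma coneM_mul_le_of_cross {C : ℝ} (hC : 0 ≤ C) {X Y : Matrix n n ℂ} (hX : X.PosSemidef)
    (hY : Y.PosSemidef) (hX0 : X ≠ 0) (hY0 : Y ≠ 0) {β : ℝ} (h : (β • Y - X).PosSemidef)
    (hcross : ∀ v w, quadForm X v * quadForm Y w ≤ C * (quadForm Y v * quadForm X w)) :
    coneM (psdCone n) X Y * coneM (psdCone n) Y X ≤ C := by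
  have hm := coneM_mem hX hY h
  have hpos := pos_of_smul_sub hX hY hX0 hm
  rw [← le_div_iff₀' hpos]
  refine coneM_le hY hX hY0 ?_
  rw [posSemidef_smul_sub_iff hY.1 hX.1]
  intro w
  rw [div_mul_eq_mul_div, le_div_iff₀ hpos]
  rcases (quadForm_nonneg hY w).eq_or_lt with h0 | h0
  · rw [← h0, zero_mul]
    exact mul_nonneg hC (quadForm_nonneg hX w)
  · rw [mul_comm, ← le_div_iff₀ h0]
    refine coneM_le hX hY hX0 ?_
    rw [posSemidef_smul_sub_iff hX.1 hY.1]
    intro v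
    rw [div_mul_eq_mul_div, le_div_iff₀ h0]
    refine (hcross v w).trans_eq (by ring)

lemma comparable_of_cross {t C : ℝ} (hC : 0 ≤ C) {X Y : Matrix n n ℂ} (hX : X.PosSemidef)
    (hY : Y.PosSemidef) (hY0 : Y ≠ 0) (h : Comparable t X Y)
    (hcross : ∀ v w, quadForm X v * quadForm Y w ≤ C * (quadForm Y v * quadForm X w)) :
    Comparable C X Y := by
  have hX0 := h.ne_zero hY hY0
  obtain ⟨β, β', -, -, -, h4, h5⟩ := h
  have e1 := coneM_mem hX hY h4
  have e2 := coneM_mem hY hX h5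
  exact ⟨_, _, pos_of_smul_sub hX hY hX0 e1, pos_of_smul_sub hY hX hY0 e2,
    coneM_mul_le_of_cross hC hX hY hX0 hY0 h4 hcross, e1, e2⟩

/-- The cross-ratios of the form `(φ, v) ↦ ⟨φ ⊗ v| Z |φ ⊗ v⟩` are bounded by `K`. -/
def CrossRatioBound (K : ℝ) (Z : Matrix (a × b) (a × b) ℂ) : Prop :=
  ∀ (φ ψ : a → ℂ) (v w : b → ℂ),
    quadForm Z (tensorVec φ v) * quadForm Z (tensorVec ψ w) ≤
      K * (quadForm Z (tensorVec ψ v) * quadForm Z (tensorVec φ w))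

lemma quadForm_swap (Z : Matrix (a × b) (a × b) ℂ) (v : b → ℂ) (φ : a → ℂ) :
    quadForm (swap Z) (tensorVec v φ) = quadForm Z (tensorVec φ v) := by
  have h1 : tensorVec v φ = tensorVec φ v ∘ Equiv.prodComm b a := by
    funext p; simp [tensorVec, mul_comm]
  have h2 : swap Z = Z.submatrix (Equiv.prodComm b a) (Equiv.prodComm b a) := rfl
  rw [quadForm, quadForm, h1, h2, Matrix.submatrix_mulVec_equiv]
  congr 1
  simp only [dotProduct, Function.comp_apply, Pi.star_apply]
  simp only [Function.comp_assoc, Equiv.self_comp_symm, Function.comp_id]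
  exact Equiv.sum_comp (Equiv.prodComm b a) fun p =>
    star (tensorVec φ v p) * (Z *ᵥ tensorVec φ v) p

lemma CrossRatioBound.swap {K : ℝ} {Z : Matrix (a × b) (a × b) ℂ} (h : CrossRatioBound K Z) :
    CrossRatioBound K (swap Z) := by
  intro v w φ ψ
  simp only [quadForm_swap]
  exact (h φ ψ v w).trans_eq (by ring)

lemma quadForm_sum {ι : Type*} (s : Finset ι) (X : ι → Matrix n n ℂ) (v : n → ℂ) :
    quadForm (∑ i ∈ s, X i) v = ∑ i ∈ s, quadForm (X i) v := by
  classical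
  induction s using Finset.induction_on with
  | empty => simp [quadForm]
  | insert i s hi ih => rw [Finset.sum_insert hi, Finset.sum_insert hi, quadForm_add, ih]

/-- Both sides are double sums over rank-one pieces of `X` and `Y`, and the bound holds term by
term. -/
lemma CrossRatioBound.contract {K : ℝ} {Z : Matrix (a × b) (a × b) ℂ} (h : CrossRatioBound K Z)
    {X Y : Matrix a a ℂ} (hX : X.PosSemidef) (hY : Y.PosSemidef) (v w : b → ℂ) :
    quadForm (contract Z X) v * quadForm (contract Z Y) w ≤
      K * (quadForm (contract Z Y) v * quadForm (contract Z X) w) := by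
  obtain ⟨D, rfl⟩ := exists_eq_conjTranspose_mul_self hX
  obtain ⟨E, rfl⟩ := exists_eq_conjTranspose_mul_self hY
  simp only [contract_conjTranspose_mul_self, quadForm_sum, quadForm_sandwich]
  rw [mul_comm (∑ l, quadForm Z (tensorVec (fun i => star (E l i)) v)), Finset.sum_mul_sum,
    Finset.sum_mul_sum, Finset.mul_sum]
  refine Finset.sum_le_sum fun i _ => ?_
  rw [Finset.mul_sum]
  refine Finset.sum_le_sum fun j _ => ?_
  rw [mul_comm (quadForm Z (tensorVec (fun i_1 => star (D i i_1)) w))]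
  exact h _ _ v w

/-- The Birkhoff–Hopf contraction theorem for the map `contract Z`. -/
theorem Comparable.contract {k r : ℝ} (hk : 1 ≤ k) (hr : 0 ≤ r) {Z : Matrix (a × b) (a × b) ℂ}
    (hZ : Z.PosSemidef) (hK : CrossRatioBound (k ^ 2) Z) {X Y : Matrix a a ℂ} (hX : X.PosSemidef)
    (hY : Y.PosSemidef) (h : Comparable (Real.exp r) X Y) :
    Comparable (Real.exp ((k - 1) / (k + 1) * r)) (contract Z X) (contract Z Y) := by
  have hκ : 0 ≤ (k - 1) / (k + 1) := div_nonneg (by linarith) (by linarith)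
  have hLX := posSemidef_contract hZ hX
  have hLY := posSemidef_contract hZ hY
  have hL := h.map (QState.contract Z) fun _ hX => posSemidef_contract hZ hX
  have hC1 : 1 ≤ Real.exp ((k - 1) / (k + 1) * r) := Real.one_le_exp (mul_nonneg hκ hr)
  by_cases hLY0 : QState.contract Z Y = 0
  · have hLX0 : QState.contract Z X = 0 := by
      by_contra h0
      obtain ⟨β, β', -, -, -, h4, -⟩ := hL
      exact ne_zero_of_smul_sub hLX h0 h4 hLY0
    rw [hLX0, hLY0]
    exact ⟨1, 1, one_pos, one_pos, by simpa using hC1, by simpa using Matrix.PosSemidef.zero,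
      by simpa using Matrix.PosSemidef.zero⟩
  have hY0 : Y ≠ 0 := by rintro rfl; exact hLY0 (map_zero _)
  have hX0 := h.ne_zero hY hY0
  refine comparable_of_cross (Real.exp_pos _).le hLX hLY hLY0 hL fun v w => ?_
  obtain ⟨β, β', hβ, hβ', hle, h4, h5⟩ := h
  have hone : 1 ≤ β * β' := one_le_of_smul_sub hX hY hX0 hβ.le h4 h5
  have hXv := quadForm_nonneg hLX v
  have hYv := quadForm_nonneg hLY v
  have hXw := quadForm_nonneg hLX w
  have hYw := quadForm_nonneg hLY w
  -- If `β * β' = 1`, then `X` and `Y` are proportional and the bounds are direct; otherwise `t - 1`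
  -- below is positive and can be cancelled.
  rcases hone.eq_or_lt with h1 | h1
  · have hUX : ∀ v, quadForm (QState.contract Z X) v ≤ β * quadForm (QState.contract Z Y) v := by
      rw [← posSemidef_smul_sub_iff hLX.1 hLY.1]
      simpa using posSemidef_contract hZ h4
    have hUY : ∀ v, quadForm (QState.contract Z Y) v ≤ β' * quadForm (QState.contract Z X) v := by
      rw [← posSemidef_smul_sub_iff hLY.1 hLX.1]
      simpa using posSemidef_contract hZ h5
    calc _ ≤ (β * quadForm (QState.contract Z Y) v) * (β' * quadForm (QState.contract Z X) w) :=
          mul_le_mul (hUX v) (hUY w) hYw (by positivity)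
      _ = 1 * (quadForm (QState.contract Z Y) v * quadForm (QState.contract Z X) w) := by
          rw [h1]; ring
      _ ≤ _ := mul_le_mul_of_nonneg_right hC1 (by positivity)
  set t := β * β' with ht
  set s := √t with hs
  have ht0 : 0 < t := by positivity
  have hs2 : s ^ 2 = t := Real.sq_sqrt ht0.le
  have hs1 : 1 ≤ s := Real.one_le_sqrt.2 hone
  have hLU := posSemidef_contract hZ h5
  have hLV := posSemidef_contract hZ h4
  set U := QState.contract Z (β' • X - Y) with hU
  set V := QState.contract Z (β • Y - X) with hV
  -- Up to factors, `X` and `Y` are positive combinations of the gaps `β' • X - Y` and `β • Y - X`.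
  -- The cross-ratio bound is applied to the images `U`, `V` of these gaps rather than to those of
  -- `X`, `Y`; this is the source of the contraction.
  have eX : ∀ v, (t - 1) * quadForm (QState.contract Z X) v = β * quadForm U v + quadForm V v := by
    intro v
    simp only [hU, hV, map_sub, map_smul, quadForm_sub, quadForm_smul, ht]
    ring
  have eY : ∀ v, (t - 1) * (β * quadForm (QState.contract Z Y) v) =
      β * quadForm U v + t * quadForm V v := by
    intro v
    simp only [hU, hV, map_sub, map_smul, quadForm_sub, quadForm_smul, ht]
    ring
  have hcr := hK.contract h5 h4 v w
  have hmain := mul_mul_le_of_cross_ratio hs1 hk (quadForm_nonneg hLV w)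
    (mul_nonneg hβ.le (quadForm_nonneg hLU w)) (quadForm_nonneg hLV v)
    (mul_nonneg hβ.le (quadForm_nonneg hLU v)) (by
      have := mul_le_mul_of_nonneg_left hcr hβ.le
      simp only [← hU, ← hV] at this
      linarith)
  rw [hs2] at hmain
  have e1 := eY w
  have e2 := eX v
  have e3 := eX w
  have e4 := eY v
  rw [add_comm (t * quadForm V w), ← e1, add_comm (quadForm V v), ← e2, add_comm (quadForm V w),
    ← e3, add_comm (t * quadForm V v), ← e4] at hmain
  have hD : 0 < (t - 1) ^ 2 * β := mul_pos (pow_pos (by linarith) 2) hβ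
  have hks : 0 < (k + s) ^ 2 := by positivity
  have h6 : quadForm (QState.contract Z X) v * quadForm (QState.contract Z Y) w ≤
      ((s * k + 1) / (k + s)) ^ 2 *
        (quadForm (QState.contract Z Y) v * quadForm (QState.contract Z X) w) := by
    rw [div_pow, div_mul_eq_mul_div, le_div_iff₀ hks]
    refine le_of_mul_le_mul_left ?_ hD
    linarith
  refine h6.trans (mul_le_mul_of_nonneg_right ?_ (mul_nonneg hYv hXw))
  refine (sq_div_le_rpow hs1 hk).trans ?_
  rw [hs2, mul_comm, Real.exp_mul]
  exact Real.rpow_le_rpow ht0.le hle hκ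

end Birkhoff

/-! ### The maximum defining `δ` and its identification with the largest cross-ratio. -/

section Diameter

open Matrix

set_option linter.unusedSectionVars false

variable {n a b : Type*} [Fintype n] [DecidableEq n] [Fintype a] [DecidableEq a] [Fintype b]
  [DecidableEq b]

lemma supp_of_posDef {X : Matrix n n ℂ} (hX : X.PosDef) : suppPow X 0 = 1 := by
  have h := self_mul_suppPow hX.posSemidef 0
  rw [zero_add, suppPow_one hX.posSemidef] at h
  exact hX.isUnit.mul_left_cancel (by rw [h, Matrix.mul_one])

lemma posDef_suppPow {X : Matrix n n ℂ} (hX : X.PosDef) (p : ℝ) : (suppPow X p).PosDef := by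
  rw [(posSemidef_suppPow hX.posSemidef p).posDef_iff_isUnit]
  have h : suppPow X p * suppPow X (-p) = 1 := by
    rw [suppPow_mul_suppPow hX.posSemidef, add_neg_cancel, supp_of_posDef hX]
  exact IsUnit.of_mul_eq_one _ h

section OpNorm

open scoped MatrixOrder Matrix.Norms.L2Operator

lemma opNorm_nonneg (X : Matrix n n ℂ) : 0 ≤ opNorm X := norm_nonneg _

lemma opNorm_le_of_posSemidef {X : Matrix n n ℂ} (hX : X.PosSemidef) {β : ℝ} (hβ : 0 ≤ β)
    (h : (β • (1 : Matrix n n ℂ) - X).PosSemidef) : opNorm X ≤ β := by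
  change ‖X‖ ≤ β
  rw [CStarAlgebra.norm_le_iff_le_algebraMap X hβ (Matrix.nonneg_iff_posSemidef.2 hX),
    Algebra.algebraMap_eq_smul_one, Matrix.le_iff]
  exact h

lemma opNorm_smul_one_sub_posSemidef {X : Matrix n n ℂ} (hX : X.PosSemidef) :
    (opNorm X • (1 : Matrix n n ℂ) - X).PosSemidef := by
  have h : X ≤ algebraMap ℝ (Matrix n n ℂ) ‖X‖ := hX.1.isSelfAdjoint.le_algebraMap_norm_self
  rwa [Algebra.algebraMap_eq_smul_one, Matrix.le_iff] at h

end OpNorm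

lemma posSemidef_conj_suppPow {X Y : Matrix n n ℂ} (hX : X.PosSemidef) (p : ℝ) :
    (suppPow Y p * X * suppPow Y p).PosSemidef := by
  have := hX.conjTranspose_mul_mul_same (suppPow Y p)
  rwa [(isHermitian_suppPow Y p).eq] at this

lemma relNorm_le {X Y : Matrix n n ℂ} (hX : X.PosSemidef) (hY : Y.PosDef) {β : ℝ} (hβ : 0 ≤ β)
    (h : (β • Y - X).PosSemidef) : relNorm X Y ≤ β := by
  refine opNorm_le_of_posSemidef (posSemidef_conj_suppPow hX _) hβ ?_
  have := posSemidef_conj_suppPow (Y := Y) h (-1 / 2)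
  have e : suppPow Y (-1 / 2) * Y * suppPow Y (-1 / 2) = 1 := by
    rw [suppPow_mul_self hY.posSemidef, suppPow_mul_suppPow hY.posSemidef]
    norm_num [supp_of_posDef hY]
  rwa [Matrix.mul_sub, Matrix.sub_mul, Matrix.mul_smul, Matrix.smul_mul, e] at this

lemma relNorm_smul_sub_posSemidef {X Y : Matrix n n ℂ} (hX : X.PosSemidef) (hY : Y.PosDef) :
    (relNorm X Y • Y - X).PosSemidef := by
  have h := opNorm_smul_one_sub_posSemidef (posSemidef_conj_suppPow (Y := Y) hX (-1 / 2))
  have := posSemidef_conj_suppPow (Y := Y) h (1 / 2)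
  have e1 : suppPow Y (1 / 2) * suppPow Y (1 / 2) = Y := by
    rw [suppPow_mul_suppPow hY.posSemidef]; norm_num [suppPow_one hY.posSemidef]
  have e2 : suppPow Y (1 / 2) * suppPow Y (-1 / 2) = 1 := by
    rw [suppPow_mul_suppPow hY.posSemidef]; norm_num [supp_of_posDef hY]
  have e3 : suppPow Y (-1 / 2) * suppPow Y (1 / 2) = 1 := by
    rw [suppPow_mul_suppPow hY.posSemidef]; norm_num [supp_of_posDef hY]
  have e4 : suppPow Y (1 / 2) * (suppPow Y (-1 / 2) * X * suppPow Y (-1 / 2)) *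
      suppPow Y (1 / 2) = X := by
    rw [Matrix.mul_assoc, Matrix.mul_assoc (suppPow Y (-1 / 2) * X), e3, Matrix.mul_one,
      ← Matrix.mul_assoc, e2, Matrix.one_mul]
  rwa [Matrix.mul_sub, Matrix.sub_mul, Matrix.mul_smul, Matrix.smul_mul, Matrix.mul_one, e1,
    e4] at this

/-- Conjugation by `Y^(1/2)` and its inverse exchanges `X ≤ β Y` with `Y^(-1/2) X Y^(-1/2) ≤ β`. -/
lemma relNorm_eq_coneM {X Y : Matrix n n ℂ} (hX : X.PosSemidef) (hX0 : X ≠ 0) (hY : Y.PosDef) :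
    relNorm X Y = coneM (psdCone n) X Y := by
  have h1 := relNorm_smul_sub_posSemidef hX hY
  have h2 := coneM_mem hX hY.posSemidef h1
  exact le_antisymm (relNorm_le hX hY (pos_of_smul_sub hX hY.posSemidef hX0 h2).le h2)
    (coneM_le hX hY.posSemidef hX0 h1)

lemma tensorVec_ne_zero {φ : a → ℂ} {v : b → ℂ} (hφ : φ ≠ 0) (hv : v ≠ 0) :
    tensorVec φ v ≠ 0 := by
  obtain ⟨i, hi⟩ := Function.ne_iff.1 hφ
  obtain ⟨j, hj⟩ := Function.ne_iff.1 hv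
  exact Function.ne_iff.2 ⟨(i, j), mul_ne_zero hi hj⟩

lemma ofLp_ne_zero_of_norm_eq_one {φ : EuclideanSpace ℂ n} (h : ‖φ‖ = 1) : φ.ofLp ≠ 0 := by
  intro h0
  have : φ = 0 := by ext i; exact congrFun h0 i
  simp [this] at h

lemma posDef_sandwich {Z : Matrix (a × b) (a × b) ℂ} (hZ : Z.PosDef) {φ : EuclideanSpace ℂ a}
    (hφ : ‖φ‖ = 1) : (sandwich Z φ).PosDef := by
  have h := posSemidef_sandwich hZ.posSemidef φ
  refine Matrix.PosDef.of_dotProduct_mulVec_pos h.1 fun {v} hv => ?_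
  refine Complex.lt_def.2 ⟨?_, (h.1.im_star_dotProduct_mulVec_self v).symm⟩
  change 0 < quadForm (sandwich Z φ) v
  rw [quadForm_sandwich]
  exact quadForm_pos hZ (tensorVec_ne_zero (ofLp_ne_zero_of_norm_eq_one hφ) hv)

lemma quadForm_vec_smul (X : Matrix n n ℂ) (c : ℂ) (v : n → ℂ) :
    quadForm X (c • v) = Complex.normSq c * quadForm X v := by
  rw [quadForm, quadForm, Matrix.mulVec_smul, star_smul, smul_dotProduct, dotProduct_smul,
    smul_smul, Complex.star_def, ← Complex.normSq_eq_conj_mul_self, smul_eq_mul,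
    Complex.re_ofReal_mul]

lemma exists_unit_scale [Nonempty n] (v : n → ℂ) :
    ∃ (u : EuclideanSpace ℂ n) (c : ℂ), ‖u‖ = 1 ∧ v = c • u.ofLp := by
  by_cases hv : v = 0
  · exact ⟨EuclideanSpace.single (Classical.arbitrary n) 1, 0, by simp, by simp [hv]⟩
  · have h0 : WithLp.toLp 2 v ≠ (0 : EuclideanSpace ℂ n) := fun h =>
      hv (by simpa using congrArg WithLp.ofLp h)
    have h1 : ((‖(WithLp.toLp 2 v : EuclideanSpace ℂ n)‖ : ℝ) : ℂ) ≠ 0 := by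
      simpa using h0
    refine ⟨((‖(WithLp.toLp 2 v : EuclideanSpace ℂ n)‖ : ℝ) : ℂ)⁻¹ • WithLp.toLp 2 v,
      (‖(WithLp.toLp 2 v : EuclideanSpace ℂ n)‖ : ℝ), norm_smul_inv_norm h0, ?_⟩
    rw [WithLp.ofLp_smul, smul_smul, mul_inv_cancel₀ h1, one_smul]

lemma tensorVec_smul_smul (c d : ℂ) (φ : a → ℂ) (v : b → ℂ) :
    tensorVec (c • φ) (d • v) = (c * d) • tensorVec φ v := by
  funext p; simp [tensorVec]; ring

/-- Both sides are homogeneous of the same degree in each vector, so the compact unit spheres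
suffice. -/
lemma crossRatioBound_of_unit [Nonempty a] [Nonempty b] {K : ℝ} {Z : Matrix (a × b) (a × b) ℂ}
    (h : ∀ (φ ψ : EuclideanSpace ℂ a) (v w : EuclideanSpace ℂ b), ‖φ‖ = 1 → ‖ψ‖ = 1 → ‖v‖ = 1 →
      ‖w‖ = 1 → quadForm Z (tensorVec φ.ofLp v.ofLp) * quadForm Z (tensorVec ψ.ofLp w.ofLp) ≤
        K * (quadForm Z (tensorVec ψ.ofLp v.ofLp) * quadForm Z (tensorVec φ.ofLp w.ofLp))) :
    CrossRatioBound K Z := by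
  intro φ ψ v w
  obtain ⟨φ', c₁, h1, rfl⟩ := exists_unit_scale φ
  obtain ⟨ψ', c₂, h2, rfl⟩ := exists_unit_scale ψ
  obtain ⟨v', d₁, h3, rfl⟩ := exists_unit_scale v
  obtain ⟨w', d₂, h4, rfl⟩ := exists_unit_scale w
  simp only [tensorVec_smul_smul, quadForm_vec_smul, Complex.normSq_mul]
  have := mul_le_mul_of_nonneg_left (h φ' ψ' v' w' h1 h2 h3 h4)
    (mul_nonneg (mul_nonneg (Complex.normSq_nonneg c₁) (Complex.normSq_nonneg d₁))
      (mul_nonneg (Complex.normSq_nonneg c₂) (Complex.normSq_nonneg d₂)))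
  refine le_trans (le_of_eq ?_) (this.trans (le_of_eq ?_)) <;> ring

lemma continuous_quadForm_tensorVec {T : Type*} [TopologicalSpace T]
    (Z : Matrix (a × b) (a × b) ℂ) {f : T → EuclideanSpace ℂ a} {g : T → EuclideanSpace ℂ b}
    (hf : Continuous f) (hg : Continuous g) :
    Continuous fun x => quadForm Z (tensorVec (f x).ofLp (g x).ofLp) := by
  unfold quadForm tensorVec Matrix.mulVec dotProduct
  simp only [Pi.star_apply]
  fun_prop

/-- The maximum of the projective distances between the images of pure states is attained, and it
bounds all cross-ratios. -/
lemma exists_isGreatest_diamValues [Nonempty a] [Nonempty b] (α : ℝ)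
    {ρ : Matrix (a × b) (a × b) ℂ} (hρ : ρ.PosDef) :
    ∃ K, 1 ≤ K ∧ IsGreatest (diamValues α ρ) K ∧ CrossRatioBound K (suppPow ρ α) := by
  set Z := suppPow ρ α with hZdef
  have hZ : Z.PosDef := posDef_suppPow hρ α
  let q : EuclideanSpace ℂ a → EuclideanSpace ℂ b → ℝ := fun φ v =>
    quadForm Z (tensorVec φ.ofLp v.ofLp)
  have hq : ∀ {φ : EuclideanSpace ℂ a} {v : EuclideanSpace ℂ b}, ‖φ‖ = 1 → ‖v‖ = 1 → 0 < q φ v :=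
    fun h1 h2 => quadForm_pos hZ (tensorVec_ne_zero (ofLp_ne_zero_of_norm_eq_one h1)
      (ofLp_ne_zero_of_norm_eq_one h2))
  let S : Set ((EuclideanSpace ℂ a × EuclideanSpace ℂ a) ×
      (EuclideanSpace ℂ b × EuclideanSpace ℂ b)) :=
    (Metric.sphere 0 1 ×ˢ Metric.sphere 0 1) ×ˢ (Metric.sphere 0 1 ×ˢ Metric.sphere 0 1)
  have hS : IsCompact S :=
    ((isCompact_sphere _ _).prod (isCompact_sphere _ _)).prod
      ((isCompact_sphere _ _).prod (isCompact_sphere _ _))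
  have hmem : ∀ {φ ψ : EuclideanSpace ℂ a} {v w : EuclideanSpace ℂ b},
      ((φ, ψ), (v, w)) ∈ S ↔ (‖φ‖ = 1 ∧ ‖ψ‖ = 1) ∧ (‖v‖ = 1 ∧ ‖w‖ = 1) := by
    intro φ ψ v w
    simp [S, Set.mem_prod]
  obtain ⟨e, -, he, -⟩ := exists_unit_scale (0 : a → ℂ)
  obtain ⟨f, -, hf, -⟩ := exists_unit_scale (0 : b → ℂ)
  -- The cross-ratio as a function on a compact product of spheres; positive definiteness keeps the
  -- denominator away from zero, so a maximum `K` exists.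
  let G : (EuclideanSpace ℂ a × EuclideanSpace ℂ a) ×
      (EuclideanSpace ℂ b × EuclideanSpace ℂ b) → ℝ := fun x =>
    (q x.1.2 x.2.1 * q x.1.1 x.2.2) / (q x.1.1 x.2.1 * q x.1.2 x.2.2)
  have hG : ContinuousOn G S := by
    refine ContinuousOn.div (Continuous.continuousOn ?_) (Continuous.continuousOn ?_) ?_
    · exact (continuous_quadForm_tensorVec Z (by fun_prop) (by fun_prop)).mul
        (continuous_quadForm_tensorVec Z (by fun_prop) (by fun_prop))
    · exact (continuous_quadForm_tensorVec Z (by fun_prop) (by fun_prop)).mul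
        (continuous_quadForm_tensorVec Z (by fun_prop) (by fun_prop))
    · rintro ⟨⟨φ, ψ⟩, v, w⟩ hx
      obtain ⟨⟨h1, h2⟩, h3, h4⟩ := hmem.1 hx
      exact (mul_pos (hq h1 h3) (hq h2 h4)).ne'
  obtain ⟨⟨⟨φ₀, ψ₀⟩, v₀, w₀⟩, hx₀, hmax⟩ :=
    hS.exists_isMaxOn ⟨((e, e), (f, f)), hmem.2 ⟨⟨he, he⟩, hf, hf⟩⟩ hG
  obtain ⟨⟨hφ₀, hψ₀⟩, hv₀, hw₀⟩ := hmem.1 hx₀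
  set K := G ((φ₀, ψ₀), (v₀, w₀)) with hKdef
  have hK1 : 1 ≤ K := by
    have := hmax (hmem.2 ⟨⟨he, he⟩, hf, hf⟩)
    have h1 : G ((e, e), (f, f)) = 1 := div_self (mul_pos (hq he hf) (hq he hf)).ne'
    simpa only [Set.mem_ofPred_eq, h1] using this
  have hK0 : 0 ≤ K := by linarith
  have hcr : CrossRatioBound K Z := by
    refine crossRatioBound_of_unit fun φ ψ v w h1 h2 h3 h4 => ?_
    have := hmax (hmem.2 ⟨⟨h2, h1⟩, h3, h4⟩)
    exact (div_le_iff₀ (mul_pos (hq h2 h3) (hq h1 h4))).1 this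
  have hne : ∀ {φ : EuclideanSpace ℂ a}, ‖φ‖ = 1 → sandwich Z φ ≠ 0 := by
    intro φ h h0
    have := quadForm_sandwich Z φ f.ofLp
    rw [h0] at this
    have h1 := hq h hf
    simp only [q, ← this] at h1
    simp [quadForm] at h1
  have hub : ∀ φ ψ : EuclideanSpace ℂ a, ‖φ‖ = 1 → ‖ψ‖ = 1 →
      relNorm (sandwich Z ψ) (sandwich Z φ) * relNorm (sandwich Z φ) (sandwich Z ψ) ≤ K := by
    intro φ ψ h1 h2
    have p1 := posDef_sandwich hZ h1
    have p2 := posDef_sandwich hZ h2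
    rw [relNorm_eq_coneM p2.posSemidef (hne h2) p1, relNorm_eq_coneM p1.posSemidef (hne h1) p2]
    refine coneM_mul_le_of_cross hK0 p2.posSemidef p1.posSemidef (hne h2) (hne h1)
      (relNorm_smul_sub_posSemidef p2.posSemidef p1) fun v w => ?_
    simp only [quadForm_sandwich]
    exact hcr _ _ v w
  refine ⟨K, hK1, ⟨⟨φ₀, ψ₀, hφ₀, hψ₀, le_antisymm ?_ (hub φ₀ ψ₀ hφ₀ hψ₀)⟩, ?_⟩, hcr⟩
  -- At the maximizer, evaluating the two operator bounds at `v₀` and `w₀` bounds `K` by the product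
  -- of the norms, so `K` belongs to `diamValues`.
  · have p1 := posDef_sandwich hZ hφ₀
    have p2 := posDef_sandwich hZ hψ₀
    have h1 := (posSemidef_smul_sub_iff p2.1 p1.1 _).1
      (relNorm_smul_sub_posSemidef p2.posSemidef p1) v₀.ofLp
    have h2 := (posSemidef_smul_sub_iff p1.1 p2.1 _).1
      (relNorm_smul_sub_posSemidef p1.posSemidef p2) w₀.ofLp
    simp only [quadForm_sandwich] at h1 h2
    refine (div_le_iff₀ (mul_pos (hq hφ₀ hv₀) (hq hψ₀ hw₀))).2 ?_
    refine (mul_le_mul h1 h2 (hq hφ₀ hw₀).le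
      (mul_nonneg (opNorm_nonneg _) (hq hφ₀ hv₀).le)).trans (le_of_eq ?_)
    simp only [q]
    ring
  · rintro r ⟨φ, ψ, h1, h2, rfl⟩
    exact hub φ ψ h1 h2

lemma tanh_log_div_four {K : ℝ} (hK : 0 < K) :
    Real.tanh (Real.log K / 4) = (√K - 1) / (√K + 1) := by
  have h1 : √K = Real.exp (Real.log K / 4) * Real.exp (Real.log K / 4) := by
    rw [← Real.exp_add, Real.sqrt_eq_rpow, Real.rpow_def_of_pos hK]
    ring_nf
  have h0 := Real.exp_pos (Real.log K / 4)
  rw [h1, Real.tanh_eq_sinh_div_cosh, Real.sinh_eq, Real.cosh_eq, Real.exp_neg]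
  field_simp

end Diameter

/-! ### Properties of minimizers and geometric convergence of the iterates. -/

section Iteration

open Matrix

set_option linter.unusedSectionVars false

variable {a b : Type*} [Fintype a] [DecidableEq a] [Fintype b] [DecidableEq b]

lemma IsState.ne_zero {n : Type*} [Fintype n] [DecidableEq n] {X : Matrix n n ℂ} (h : IsState X) :
    X ≠ 0 := by
  rintro rfl
  simpa using h.2

lemma posSemidef_normalize {n : Type*} [Fintype n] [DecidableEq n] {X : Matrix n n ℂ}
    (hX : X.PosSemidef) : (normalize X).PosSemidef := by
  rw [normalize_eq hX]
  exact hX.smul (inv_nonneg.2 (Complex.le_def.1 hX.trace_nonneg).1)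

lemma suppPow_mul_eq_iff {n : Type*} [Fintype n] [DecidableEq n] {ρ P : Matrix n n ℂ}
    (hρ : ρ.PosSemidef) (p : ℝ) : suppPow ρ p * P = suppPow ρ p ↔ ρ * P = ρ := by
  constructor <;> intro h
  · have : ρ = suppPow ρ (1 - p) * suppPow ρ p := by
      rw [suppPow_mul_suppPow hρ, sub_add_cancel, suppPow_one hρ]
    conv_lhs => rw [this, Matrix.mul_assoc, h, ← this]
  · have : suppPow ρ p = suppPow ρ (p - 1) * ρ := by
      rw [suppPow_mul_self hρ, sub_add_cancel]
    conv_lhs => rw [this, Matrix.mul_assoc, h, ← this]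

lemma absCont_kronecker_iff {ρ : Matrix (a × b) (a × b) ℂ} (hρ : ρ.PosSemidef) (α : ℝ)
    {σ : Matrix a a ℂ} {τ : Matrix b b ℂ} (hσ : σ.PosSemidef) (hτ : τ.PosSemidef) :
    AbsCont ρ (σ ⊗ₖ τ) ↔ suppPow ρ α * (suppPow σ 0 ⊗ₖ suppPow τ 0) = suppPow ρ α := by
  rw [absCont_iff (hσ.kronecker hτ), suppPow_kronecker hσ hτ, suppPow_mul_eq_iff hρ]

lemma trace_suppPow_kronecker_pos {Z : Matrix (a × b) (a × b) ℂ} (hZ : Z.PosSemidef)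
    (hZ0 : Z ≠ 0) {σ : Matrix a a ℂ} {τ : Matrix b b ℂ} (hσ : σ.PosSemidef) (hτ : τ.PosSemidef)
    (hs : Z * (suppPow σ 0 ⊗ₖ suppPow τ 0) = Z) (p : ℝ) :
    0 < (Z * (suppPow σ p ⊗ₖ suppPow τ p)).trace.re := by
  have hM := (posSemidef_suppPow hσ p).kronecker (posSemidef_suppPow hτ p)
  have h := Complex.le_def.1 (trace_mul_nonneg hZ hM)
  refine lt_of_le_of_ne h.1 fun h0 => hZ0 ?_
  have h1 : Z * (suppPow σ p ⊗ₖ suppPow τ p) = 0 :=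
    mul_eq_zero_of_trace_mul hZ hM (Complex.ext h0.symm h.2.symm)
  rw [← hs, ← add_neg_cancel p, ← suppPow_mul_suppPow hσ, ← suppPow_mul_suppPow hτ,
    Matrix.mul_kronecker_mul, ← Matrix.mul_assoc, h1, Matrix.zero_mul]

lemma petzD_kronecker {α : ℝ} {ρ : Matrix (a × b) (a × b) ℂ} (hρ : ρ.PosSemidef)
    {σ : Matrix a a ℂ} {τ : Matrix b b ℂ} (hσ : σ.PosSemidef) (hτ : τ.PosSemidef)
    (hs : suppPow ρ α * (suppPow σ 0 ⊗ₖ suppPow τ 0) = suppPow ρ α) :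
    petzD α ρ (σ ⊗ₖ τ) = ((1 / (α - 1) * Real.log
      (suppPow ρ α * (suppPow σ (1 - α) ⊗ₖ suppPow τ (1 - α))).trace.re : ℝ) : EReal) := by
  rw [petzD, if_pos (Or.inr ((absCont_kronecker_iff hρ α hσ hτ).2 hs)), suppPow_kronecker hσ hτ]

lemma supp_normalize_one {n : Type*} [Fintype n] [DecidableEq n] (h : (1 : Matrix n n ℂ) ≠ 0) :
    suppPow (normalize (1 : Matrix n n ℂ)) 0 = 1 := by
  rw [normalize_eq Matrix.PosSemidef.one, suppPow_zero_smul Matrix.PosSemidef.one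
    (inv_pos.2 (trace_re_pos Matrix.PosSemidef.one h)), suppPow_one_matrix]

/-- The pair of maximally mixed states gives a finite divergence, so a minimizer cannot have the
value `⊤`. -/
lemma minimizer_supp {α : ℝ} (hα : 1 < α) {ρ : Matrix (a × b) (a × b) ℂ} (hρ : IsState ρ)
    {σ : Matrix a a ℂ} {τ : Matrix b b ℂ} (hmin : (σ, τ) ∈ minimizers α ρ) :
    suppPow ρ α * (suppPow σ 0 ⊗ₖ suppPow τ 0) = suppPow ρ α := by
  obtain ⟨⟨hσ, hτ⟩, hle⟩ := hmin
  by_contra h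
  have htop : petzD α ρ (σ ⊗ₖ τ) = ⊤ := by
    rw [petzD, if_neg]
    rintro (h' | h')
    · exact absurd h'.1 hα.not_gt
    · exact h ((absCont_kronecker_iff hρ.1 α hσ.1 hτ.1).1 h')
  have h1a : (1 : Matrix a a ℂ) ≠ 0 := fun h0 => hσ.ne_zero (by rw [← Matrix.mul_one σ, h0,
    Matrix.mul_zero])
  have h1b : (1 : Matrix b b ℂ) ≠ 0 := fun h0 => hτ.ne_zero (by rw [← Matrix.mul_one τ, h0,
    Matrix.mul_zero])
  have hA := isState_normalize Matrix.PosSemidef.one h1a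
  have hB := isState_normalize Matrix.PosSemidef.one h1b
  have hle' := hle _ _ hA hB
  change petzD α ρ (σ ⊗ₖ τ) ≤ _ at hle'
  rw [htop, petzD_kronecker hρ.1 hA.1 hB.1, top_le_iff] at hle'
  · exact EReal.coe_ne_top _ hle'
  · rw [supp_normalize_one h1a, supp_normalize_one h1b, Matrix.one_kronecker_one, Matrix.mul_one]

lemma minimizer_trace_le {α : ℝ} (hα : 1 < α) {ρ : Matrix (a × b) (a × b) ℂ} (hρ : IsState ρ)
    {σ : Matrix a a ℂ} {τ : Matrix b b ℂ} (hmin : (σ, τ) ∈ minimizers α ρ)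
    {σ' : Matrix a a ℂ} {τ' : Matrix b b ℂ} (hσ' : IsState σ') (hτ' : IsState τ')
    (hs' : suppPow ρ α * (suppPow σ' 0 ⊗ₖ suppPow τ' 0) = suppPow ρ α) :
    (suppPow ρ α * (suppPow σ (1 - α) ⊗ₖ suppPow τ (1 - α))).trace.re ≤
      (suppPow ρ α * (suppPow σ' (1 - α) ⊗ₖ suppPow τ' (1 - α))).trace.re := by
  have hs := minimizer_supp hα hρ hmin
  obtain ⟨⟨hσ, hτ⟩, hle⟩ := hmin
  have hZ := posSemidef_suppPow hρ.1 α
  have hZ0 : suppPow ρ α ≠ 0 := by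
    rw [Ne, suppPow_eq_zero_iff hρ.1 (by linarith)]; exact hρ.ne_zero
  have h := hle _ _ hσ' hτ'
  change petzD α ρ (σ ⊗ₖ τ) ≤ _ at h
  rw [petzD_kronecker hρ.1 hσ.1 hτ.1 hs, petzD_kronecker hρ.1 hσ'.1 hτ'.1 hs',
    EReal.coe_le_coe_iff] at h
  have h1 := le_of_mul_le_mul_left h (one_div_pos.2 (sub_pos.2 hα))
  exact (Real.log_le_log_iff (trace_suppPow_kronecker_pos hZ hZ0 hσ.1 hτ.1 hs _)
    (trace_suppPow_kronecker_pos hZ hZ0 hσ'.1 hτ'.1 hs' _)).1 h1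

lemma minimizer_snd_eq {α : ℝ} (hα : 1 < α) {ρ : Matrix (a × b) (a × b) ℂ} (hρ : IsState ρ)
    {σ : Matrix a a ℂ} {τ : Matrix b b ℂ} (hmin : (σ, τ) ∈ minimizers α ρ) :
    τ = NAB α ρ σ := by
  have hZ0 : suppPow ρ α ≠ 0 := by
    rw [Ne, suppPow_eq_zero_iff hρ.1 (by linarith)]; exact hρ.ne_zero
  rw [NAB_eq]
  exact eq_normalize_of_minimizer hα (posSemidef_suppPow hρ.1 α) hZ0 hmin.1.1.1 hmin.1.2
    (minimizer_supp hα hρ hmin) fun τ' hτ' hs' => minimizer_trace_le hα hρ hmin hmin.1.1 hτ' hs'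

lemma swap_mul_kronecker (Z : Matrix (a × b) (a × b) ℂ) (X : Matrix a a ℂ) (Y : Matrix b b ℂ) :
    swap Z * (Y ⊗ₖ X) = swap (Z * (X ⊗ₖ Y)) := by
  rw [swap_mul, swap_kronecker]

lemma swap_ne_zero {Z : Matrix (a × b) (a × b) ℂ} (h : Z ≠ 0) : swap Z ≠ 0 := by
  intro h0
  apply h
  rw [← swap_swap Z, h0]
  rfl

lemma minimizer_fst_eq {α : ℝ} (hα : 1 < α) {ρ : Matrix (a × b) (a × b) ℂ} (hρ : IsState ρ)
    {σ : Matrix a a ℂ} {τ : Matrix b b ℂ} (hmin : (σ, τ) ∈ minimizers α ρ) :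
    σ = NBA α ρ τ := by
  have hZ0 : suppPow ρ α ≠ 0 := by
    rw [Ne, suppPow_eq_zero_iff hρ.1 (by linarith)]; exact hρ.ne_zero
  rw [NBA_eq]
  refine eq_normalize_of_minimizer hα (posSemidef_swap (posSemidef_suppPow hρ.1 α))
    (swap_ne_zero hZ0) hmin.1.2.1 hmin.1.1 ?_ fun σ' hσ' hs' => ?_
  · rw [swap_mul_kronecker, minimizer_supp hα hρ hmin]
  · rw [swap_mul_kronecker, swap_mul_kronecker, trace_swap, trace_swap]
    refine minimizer_trace_le hα hρ hmin hσ' hmin.1.2 ?_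
    rw [swap_mul_kronecker] at hs'
    rw [← swap_swap (suppPow ρ α * _), hs', swap_swap]

/-- Needed to make the initial distance finite: `σ₀` is only assumed to share its support with the
marginal. -/
lemma minimizer_fst_supp {α : ℝ} (hα : 1 < α) {ρ : Matrix (a × b) (a × b) ℂ} (hρ : IsState ρ)
    {σ : Matrix a a ℂ} {τ : Matrix b b ℂ} (hmin : (σ, τ) ∈ minimizers α ρ) :
    suppPow σ 0 = suppPow (trB ρ) 0 := by
  have hZ0 : suppPow ρ α ≠ 0 := by
    rw [Ne, suppPow_eq_zero_iff hρ.1 (by linarith)]; exact hρ.ne_zero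
  conv_lhs => rw [minimizer_fst_eq hα hρ hmin, NBA_eq]
  rw [trB_eq_trA_swap]
  refine supp_normalize_contract hα (A := swap (suppPow ρ (α - 1)))
    (B := swap (suppPow ρ (1 - α))) (posSemidef_swap (posSemidef_suppPow hρ.1 α))
    (posSemidef_swap hρ.1) ?_ ?_ (swap_ne_zero hZ0) (posSemidef_suppPow hmin.1.2.1 _) ?_
  · rw [← swap_mul, suppPow_mul_self hρ.1, sub_add_cancel]
  · rw [← swap_mul, suppPow_mul_suppPow hρ.1, sub_add_cancel, suppPow_one hρ.1]
  · rw [suppPow_suppPow hmin.1.2.1, mul_zero]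
    refine mul_kronecker_one_of_mul_kronecker (R := suppPow σ 0) ?_ (supp_mul_supp hmin.1.2.1)
    rw [swap_mul_kronecker, minimizer_supp hα hρ hmin]

/-- Contraction of one update step, given the contraction ratio `κ` of its linear part. -/
lemma Comparable.update {α κ γ r : ℝ} (hα₁ : 1 < α) (hα₂ : α ≤ 2) (hγ : γ = |1 - 1 / α|)
    (hr : 0 ≤ r) {Z : Matrix (a × b) (a × b) ℂ} (hZ : Z.PosSemidef)
    (hκ : ∀ (r : ℝ) (X Y : Matrix a a ℂ), 0 ≤ r → X.PosSemidef → Y.PosSemidef →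
      Comparable (Real.exp r) X Y →
      Comparable (Real.exp (κ * r)) (QState.contract Z X) (QState.contract Z Y))
    {X Y : Matrix a a ℂ} (hX : X.PosSemidef) (hY : Y.PosSemidef)
    (h0 : normalize (QState.suppPow (QState.contract Z (QState.suppPow Y (1 - α))) (1 / α)) ≠ 0)
    (h : Comparable (Real.exp r) X Y) :
    Comparable (Real.exp (γ * κ * r))
      (normalize (QState.suppPow (QState.contract Z (QState.suppPow X (1 - α))) (1 / α)))
      (normalize (QState.suppPow (QState.contract Z (QState.suppPow Y (1 - α))) (1 / α))) := by
  have hα0 : 0 < α := by linarith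
  -- The last side condition is `α - 1 ≤ 1`, where `α ≤ 2` is used.
  have h1 := h.suppPow_neg hX hY (p := α - 1) (by linarith) (by linarith)
  rw [neg_sub, ← Real.exp_mul] at h1
  have hLX := posSemidef_contract hZ (posSemidef_suppPow hX (1 - α))
  have hLY := posSemidef_contract hZ (posSemidef_suppPow hY (1 - α))
  have h2 := (hκ _ _ _ (mul_nonneg hr (by linarith)) (posSemidef_suppPow hX _)
    (posSemidef_suppPow hY _) h1).suppPow hLX hLY (p := 1 / α) (by positivity)
    ((div_le_one hα0).2 hα₁.le)
  have hγ' : γ = (α - 1) / α := by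
    rw [hγ, abs_of_nonneg]
    · field_simp
    · rw [sub_nonneg, div_le_one hα0]; exact hα₁.le
  rw [← Real.exp_mul] at h2
  have e : κ * (r * (α - 1)) * (1 / α) = γ * κ * r := by rw [hγ']; field_simp
  rw [e] at h2
  have hSX := posSemidef_suppPow hLX (1 / α)
  have hSY := posSemidef_suppPow hLY (1 / α)
  have hSY0 : QState.suppPow (QState.contract Z (QState.suppPow Y (1 - α))) (1 / α) ≠ 0 := by
    intro h'
    rw [h'] at h0
    exact h0 (by rw [normalize, smul_zero])
  have hSX0 := h2.ne_zero hSY hSY0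
  rw [normalize_eq hSX, normalize_eq hSY]
  exact h2.smul (inv_pos.2 (trace_re_pos hSX hSX0)) (inv_pos.2 (trace_re_pos hSY hSY0))

lemma posSemidef_NAB (α : ℝ) {ρ : Matrix (a × b) (a × b) ℂ} (hρ : ρ.PosSemidef)
    {σ : Matrix a a ℂ} (hσ : σ.PosSemidef) : (NAB α ρ σ).PosSemidef := by
  rw [NAB_eq]
  exact posSemidef_normalize (posSemidef_suppPow
    (posSemidef_contract (posSemidef_suppPow hρ α) (posSemidef_suppPow hσ _)) _)

lemma posSemidef_NBA (α : ℝ) {ρ : Matrix (a × b) (a × b) ℂ} (hρ : ρ.PosSemidef)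
    {τ : Matrix b b ℂ} (hτ : τ.PosSemidef) : (NBA α ρ τ).PosSemidef := by
  rw [NBA_eq]
  exact posSemidef_normalize (posSemidef_suppPow
    (posSemidef_contract (posSemidef_swap (posSemidef_suppPow hρ α)) (posSemidef_suppPow hτ _)) _)

lemma posSemidef_sigmaSeq (α : ℝ) {ρ : Matrix (a × b) (a × b) ℂ} (hρ : ρ.PosSemidef)
    {σ₀ : Matrix a a ℂ} (hσ₀ : σ₀.PosSemidef) : ∀ n, (sigmaSeq α ρ σ₀ n).PosSemidef
  | 0 => hσ₀
  | n + 1 => posSemidef_NBA α hρ (posSemidef_NAB α hρ (posSemidef_sigmaSeq α hρ hσ₀ n))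

/-- Geometric convergence of alternating minimization, given a common contraction ratio `κ` of the
linear parts of both update maps. -/
theorem dH_sigmaSeq_le_and_dH_tauSeq_le {α κ γ : ℝ} (hα₁ : 1 < α) (hα₂ : α ≤ 2)
    (hγ : γ = |1 - 1 / α|) (hκ0 : 0 ≤ κ) {ρ : Matrix (a × b) (a × b) ℂ} (hρ : IsState ρ)
    (hκA : ∀ (r : ℝ) (X Y : Matrix a a ℂ), 0 ≤ r → X.PosSemidef → Y.PosSemidef →
      Comparable (Real.exp r) X Y → Comparable (Real.exp (κ * r))
        (contract (suppPow ρ α) X) (contract (suppPow ρ α) Y))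
    (hκB : ∀ (r : ℝ) (X Y : Matrix b b ℂ), 0 ≤ r → X.PosSemidef → Y.PosSemidef →
      Comparable (Real.exp r) X Y → Comparable (Real.exp (κ * r))
        (contract (swap (suppPow ρ α)) X) (contract (swap (suppPow ρ α)) Y))
    {σhat : Matrix a a ℂ} {τhat : Matrix b b ℂ} (hmin : (σhat, τhat) ∈ minimizers α ρ)
    {σ₀ : Matrix a a ℂ} (hσ₀ : IsState σ₀) (hσ₀ρ : SameSupp σ₀ (trB ρ)) (n : ℕ) :
    dH (sigmaSeq α ρ σ₀ n) σhat ≤ (((γ * κ) ^ (2 * n) : ℝ) : EReal) * dH σ₀ σhat ∧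
      dH (tauSeq α ρ σ₀ n) τhat ≤ (((γ * κ) ^ (2 * n + 1) : ℝ) : EReal) * dH σ₀ σhat := by
  have hσ := hmin.1.1
  have hτ := hmin.1.2
  have hτeq := minimizer_snd_eq hα₁ hρ hmin
  have hσeq := minimizer_fst_eq hα₁ hρ hmin
  have hZ := posSemidef_suppPow hρ.1 α
  have htrB : (trB ρ).PosSemidef := by
    rw [trB_eq_trA_swap, ← contract_one]
    exact posSemidef_contract (posSemidef_swap hρ.1) Matrix.PosSemidef.one
  have hsupp : suppPow σ₀ 0 = suppPow σhat 0 := by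
    rw [(sameSupp_iff hσ₀.1 htrB).1 hσ₀ρ, minimizer_fst_supp hα₁ hρ hmin]
  obtain ⟨t, ht⟩ := exists_comparable hσ₀.1 hσ.1 hsupp
  obtain ⟨d, hd0, hd, hcomp⟩ := exists_dH_eq hσ₀.1 hσ.1 hσ.ne_zero ht
  have hγ0 : 0 ≤ γ * κ := mul_nonneg (hγ ▸ abs_nonneg _) hκ0
  have hσn := posSemidef_sigmaSeq α hρ.1 hσ₀.1
  have stepA : ∀ {r : ℝ} {σ : Matrix a a ℂ}, 0 ≤ r → σ.PosSemidef →
      Comparable (Real.exp r) σ σhat → Comparable (Real.exp (γ * κ * r)) (NAB α ρ σ) τhat := by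
    intro r σ hr hσp h
    have hne := hτ.ne_zero
    change τhat ≠ 0 at hne
    -- Replacing the minimizer by its own update turns the claim into contraction between two images
    -- of the same map.
    rw [hτeq, NAB_eq] at hne ⊢
    exact h.update hα₁ hα₂ hγ hr hZ hκA hσp hσ.1 hne
  have stepB : ∀ {r : ℝ} {τ : Matrix b b ℂ}, 0 ≤ r → τ.PosSemidef →
      Comparable (Real.exp r) τ τhat → Comparable (Real.exp (γ * κ * r)) (NBA α ρ τ) σhat := by
    intro r τ hr hτp h
    have hne := hσ.ne_zero
    change σhat ≠ 0 at hne
    rw [hσeq, NBA_eq] at hne ⊢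
    rw [NBA_eq]
    exact h.update hα₁ hα₂ hγ hr (posSemidef_swap hZ) hκB hτp hτ.1 hne
  have hA : ∀ n, Comparable (Real.exp ((γ * κ) ^ (2 * n) * d)) (sigmaSeq α ρ σ₀ n) σhat := by
    intro n
    induction n with
    | zero => rwa [mul_zero, pow_zero, one_mul]
    | succ n ih =>
      have h1 := stepB (by positivity) (posSemidef_NAB α hρ.1 (hσn n))
        (stepA (by positivity) (hσn n) ih)
      have e : γ * κ * (γ * κ * ((γ * κ) ^ (2 * n) * d)) = (γ * κ) ^ (2 * (n + 1)) * d := by ring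
      rw [e] at h1
      exact h1
  rw [hd, ← EReal.coe_mul, ← EReal.coe_mul]
  refine ⟨dH_le_of_comparable (hσn n) hσ.1 hσ.ne_zero (hA n),
    dH_le_of_comparable (posSemidef_NAB α hρ.1 (hσn n)) hτ.1 hτ.ne_zero ?_⟩
  have h1 := stepA (by positivity) (hσn n) (hA n)
  have e : γ * κ * ((γ * κ) ^ (2 * n) * d) = (γ * κ) ^ (2 * n + 1) * d := by ring
  rwa [e] at h1

end Iteration

end QState

theorem corollary1 {a b : Type*} [Fintype a] [DecidableEq a] [Fintype b] [DecidableEq b]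
    (α : ℝ) (hα₁ : 1 < α) (hα₂ : α ≤ 2)
    (ρ : Matrix (a × b) (a × b) ℂ) (hρ : QState.IsState ρ)
    (σhat : Matrix a a ℂ) (τhat : Matrix b b ℂ)
    (hmin : (σhat, τhat) ∈ QState.minimizers α ρ)
    (σ₀ : Matrix a a ℂ) (hσ₀ : QState.IsState σ₀) (hσ₀ρ : QState.SameSupp σ₀ (QState.trB ρ))
    (γ : ℝ) (hγ : γ = |1 - 1 / α|) :
    (∀ n : ℕ,
      QState.dH (QState.sigmaSeq α ρ σ₀ n) σhat
          ≤ ((γ ^ (2 * n) : ℝ) : EReal) * QState.dH σ₀ σhat ∧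
      QState.dH (QState.tauSeq α ρ σ₀ n) τhat
          ≤ ((γ ^ (2 * n + 1) : ℝ) : EReal) * QState.dH σ₀ σhat) ∧
    (ρ.PosDef →
      IsGreatest (QState.diamValues α ρ) (sSup (QState.diamValues α ρ)) ∧
      0 ≤ QState.kappa α ρ ∧ QState.kappa α ρ < 1 ∧
      ∀ n : ℕ,
        QState.dH (QState.sigmaSeq α ρ σ₀ n) σhat
            ≤ (((γ * QState.kappa α ρ) ^ (2 * n) : ℝ) : EReal) * QState.dH σ₀ σhat ∧
        QState.dH (QState.tauSeq α ρ σ₀ n) τhat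
            ≤ (((γ * QState.kappa α ρ) ^ (2 * n + 1) : ℝ) : EReal) * QState.dH σ₀ σhat) := by
  have hZ := QState.posSemidef_suppPow hρ.1 α
  constructor
  · intro n
    -- Positive linear maps preserve both order bounds, so ratio `1` is always available.
    have := QState.dH_sigmaSeq_le_and_dH_tauSeq_le (κ := 1) hα₁ hα₂ hγ zero_le_one hρ
      (fun r X Y _ _ _ h => by
        rw [one_mul]
        exact h.map _ fun _ hX => QState.posSemidef_contract hZ hX)
      (fun r X Y _ _ _ h => by
        rw [one_mul]
        exact h.map _ fun _ hX => QState.posSemidef_contract (QState.posSemidef_swap hZ) hX)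
      hmin hσ₀ hσ₀ρ n
    rwa [mul_one] at this
  · intro hpd
    have hne : Nonempty (a × b) := by
      by_contra h
      rw [not_nonempty_iff] at h
      exact hρ.ne_zero (Subsingleton.elim _ _)
    have : Nonempty a := hne.map Prod.fst
    have : Nonempty b := hne.map Prod.snd
    obtain ⟨K, hK1, hK, hcr⟩ := QState.exists_isGreatest_diamValues α hpd
    have hK0 : 0 < K := by linarith
    have hκ : QState.kappa α ρ = (√K - 1) / (√K + 1) := by
      rw [QState.kappa, QState.delta, hK.csSup_eq, QState.tanh_log_div_four hK0]
    have hk : 1 ≤ √K := Real.one_le_sqrt.2 hK1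
    -- The contraction theorem takes the cross-ratio bound as `k ^ 2`; with `k = √K` its ratio `(k -
    -- 1) / (k + 1)` is `kappa`.
    rw [← Real.sq_sqrt hK0.le] at hcr
    have hκ0 : 0 ≤ QState.kappa α ρ := by
      rw [hκ]
      exact div_nonneg (by linarith) (by linarith)
    refine ⟨by rwa [hK.csSup_eq], hκ0, Real.tanh_lt_one _, fun n => ?_⟩
    refine QState.dH_sigmaSeq_le_and_dH_tauSeq_le hα₁ hα₂ hγ hκ0 hρ ?_ ?_ hmin hσ₀ hσ₀ρ n
    · intro r X Y hr hX hY h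
      rw [hκ]
      exact h.contract hk hr hZ hcr hX hY
    · intro r X Y hr hX hY h
      rw [hκ]
      exact h.contract hk hr (QState.posSemidef_swap hZ) hcr.swap hX hY
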